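/- **Final payoff improvement guarantee.** Let $\mathcal S\subseteq\mathbb R^n$ be open and convex, $\mathcal A\subseteq\mathbb R^m$ convex, and let $(\mathcal S,\mathcal A,P,R,\mu,\gamma)$ be a discounted Markov decision process: $P$ is a Markov kernel from $\mathcal S\times\mathcal A$ to $\mathcal S$, $R:\mathcal S\times\mathcal A\to[0,R_{\max}]$ is measurable, $\mu$ is the initial state distribution and $\gamma\in[0,1)$. A policy is a Markov kernel $\pi$ from $\mathcal S$ to $\mathcal A$. For a state distribution $\nu$ put $\mathbb P(\nu,\pi)=\mathbb E_{s\sim\nu,\,a\sim\pi(s)}[P(s,a)]$, $\mathbb P^0(\nu,\pi)=\nu$, $\mathbb P^{t+1}(\nu,\pi)=\mathbb P(\mathbb P^{t}(\nu,\pi),\pi)$, and $$\rho^\pi=(1-\gamma)\sum_{t\ge0}\gamma^t\,\mathbb P^t(\mu,\pi),\qquad V^\pi(s)=\mathbb E\Big[\sum_{t\ge0}\gamma^tR(s_t,a_t)\,\Big|\,s_0=s,\ a_t\sim\pi(s_t),\ s_{t+1}\sim P(s_t,a_t)\Big],$$ $$Q^\pi(s,a)=R(s,a)+\gamma\,\mathbb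 E_{s'\sim P(s,a)}[V^\pi(s')],\qquad A^\pi(s,\pi')=\mathbb E_{a\sim\pi'(s)}[Q^\pi(s,a)-V^\pi(s)],\qquad \eta_\pi=\mathbb E_{s\sim\mu}[V^\pi(s)].$$ $W$ denotes the ($1$-)Wasserstein distance for the Euclidean distance, with values in $[0,\infty]$, and $W(\pi_1,\pi_2)=\sup_sW(\pi_1(\cdot|s),\pi_2(\cdot|s))$. For a differentiable function $f$ put $\mathrm{Lip}(f;x)=\sup_x\|\nabla_xf\|_2$. Let $\pi_1,\pi_2$ be policies and $L_\pi\ge0$, $L\in\mathbb R$. Assume: 1. $Q^{\pi_1}(s,a)$ is differentiable in $a$ and in $s$, the partial derivatives $\partial_{s^{(j)}}Q^{\pi_1}(s,a)$ are differentiable in $a$, and the constants $$\sup_s\mathrm{Lip}(Q^{\pi_1}(s,a);a)\quad\text{and}\quad\sup_s\|\mathrm{Lip}(\nabla_sQ^{\pi_1}(s,a);a)\|_2$$ are finite; here $\mathrm{Lip}(\nabla_sQ^{\pi_1}(s,a);a)$ is the vector of the constants $\mathrm{Lip}(\partial_{s^{(j)}}Q^{\pi_1}(s,a);a)$, $j=1,\dots,n$.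 2. $W(\mathbb P(\nu,\pi_1),\mathbb P(\nu,\pi_2))\le L_\pi\,W(\pi_1,\pi_2)$ for all state distributions $\nu$. 3. One of the following holds. * (Lipschitz in the state distribution) $L=L_\mu\ge0$ with $\gamma L_\mu<1$, and $W(\mathbb P(\nu_1,\pi),\mathbb P(\nu_2,\pi))\le L_\mu\,W(\nu_1,\nu_2)$ for all state distributions $\nu_1,\nu_2$ and $\pi\in\{\pi_1,\pi_2\}$. * (Stability) $|\gamma L|<1$ and $C_L:=\sup_t\sum_{k=1}^t\hat L^{(t-k)}\prod_{i=1}^{k-1}\tilde L^{(t-i)}\le L_\pi\sum_{t\ge0}(\gamma L)^t$. Here, with $\nu_{i}=\mathbb P^t(\mu,\pi_i)$, $\tilde L^{(t)}$ and $\hat L^{(t)}$ are the infima of the numbers in $[0,\infty]$ satisfying $W(\mathbb P(\nu_1,\pi_2),\mathbb P(\nu_2,\pi_2))=\tilde L^{(t)}\,W(\nu_1,\nu_2)$ and $W(\mathbb P(\nu_1,\pi_1),\mathbb P(\nu_1,\pi_2))=\hat L^{(t)}\,W(\pi_1,\pi_2)$, respectively. Put $$C_1'=\sup_s\frac{2\,\mathrm{Lip}(Q^{\pi_1}(s,a);a)\,\gamma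 L_\pi}{(1-\gamma)(1-\gamma L)},\qquad C_2'=\sup_s\frac{\|\mathrm{Lip}(\nabla_sQ^{\pi_1}(s,a);a)\|_2\,\gamma L_\pi}{(1-\gamma)(1-\gamma L)},$$ and, for an arbitrary real $\alpha\ne0$, $C_1=\tfrac{\alpha^2}{2}C_1'$ and $C_2=C_2'+\tfrac{1}{2\alpha^2}C_1'$. Let $$\mathcal L_{G^2}(\pi_1,\pi_2;s)=\Big\|\nabla_{s'}W\Big(\tfrac{\pi_2(\cdot|s')+\pi_1(\cdot|s)}2,\tfrac{\pi_2(\cdot|s)+\pi_1(\cdot|s')}2\Big)\Big|_{s'=s}\Big\|_2^2=\sum_{j=1}^n\bigg(\limsup_{h\to0}\frac1{|h|}W\Big(\tfrac{\pi_2(\cdot|s+he_j)+\pi_1(\cdot|s)}2,\tfrac{\pi_2(\cdot|s)+\pi_1(\cdot|s+he_j)}2\Big)\bigg)^2 ,$$ where the right-hand side is the meaning of the middle expression (the function of $s'$ is nonnegative and vanishes at $s'=s$, where it generally has a kink). Then $$\eta_{\pi_2}\ \ge\ \eta_{\pi_1}+\frac1{1-\gamma}\,\mathbb E_{s\sim\rho^{\pi_1}}\big[A^{\pi_1}(s,\pi_2)\big]-C_1\,\sup_s\mathcal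 L_{G^2}(\pi_1,\pi_2;s)-C_2\,\sup_sW(\pi_2(\cdot|s),\pi_1(\cdot|s))^2,$$ where the right-hand side is $-\infty$ if a subtracted term is infinite, and $0\cdot\infty=0$. -/

import Mathlib

open MeasureTheory ProbabilityTheory Filter Topology
open scoped ENNReal NNReal

noncomputable section

namespace TDPO

/-! ### Wasserstein distance -/

/-- The Wasserstein distance `W(ζ, ν)`: infimum over all couplings `c` of `ζ` and `ν` of
`∫ ‖x - y‖ dc(x, y)`, with values in `[0, ∞]`. -/
def W {X : Type*} [PseudoEMetricSpace X] [MeasurableSpace X] (ζ ν : Measure X) : ℝ≥0∞ :=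
  ⨅ (c : Measure (X × X)) (_ : c.map Prod.fst = ζ ∧ c.map Prod.snd = ν),
    ∫⁻ p, edist p.1 p.2 ∂c

/-- The policy distance `W(π₁, π₂) = sup_s W(π₁(·|s), π₂(·|s))`. -/
def policyW {X Y : Type*} [MeasurableSpace X] [PseudoEMetricSpace Y] [MeasurableSpace Y]
    (π₁ π₂ : Kernel X Y) : ℝ≥0∞ :=
  ⨆ s, W (π₁ s) (π₂ s)

/-! ### Markov decision processes -/

/-- A discounted Markov decision process `(X, Y, P, R, μ, γ)` with state space `X`, action space
`Y` and a reward with values in `[0, Rmax]`. A policy is a Markov kernel from `X` to `Y`. -/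
structure MDP (X Y : Type*) [MeasurableSpace X] [MeasurableSpace Y] where
  /-- transition dynamics -/
  P : Kernel (X × Y) X
  markov : IsMarkovKernel P
  /-- reward -/
  R : X → Y → ℝ
  measurable_R : Measurable fun p : X × Y => R p.1 p.2
  /-- upper bound of the reward -/
  Rmax : ℝ
  R_nonneg : ∀ s a, 0 ≤ R s a
  R_le : ∀ s a, R s a ≤ Rmax
  /-- initial state distribution -/
  μ : Measure X
  prob : IsProbabilityMeasure μ
  /-- discount factor -/
  γ : ℝ
  γ_nonneg : 0 ≤ γ
  γ_lt_one : γ < 1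

namespace MDP

variable {X Y : Type*} [MeasurableSpace X] [MeasurableSpace Y] (M : MDP X Y)

/-- `ℙ(ν, π)`: the law of `s' ∼ P(s, a)` with `s ∼ ν` and `a ∼ π(s)`. -/
def step (π : Kernel X Y) (ν : Measure X) : Measure X :=
  ν.bind (M.P ∘ₖ (Kernel.id ×ₖ π))

/-- The `t`-step dynamics `ℙᵗ(ν, π)`. -/
def stepN (π : Kernel X Y) (ν : Measure X) : ℕ → Measure X
  | 0 => ν
  | t + 1 => M.step π (stepN π ν t)

/-- The discounted visitation frequency `(1 - γ) ∑ₜ γᵗ ℙᵗ(ν, π)`. -/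
def visitation (π : Kernel X Y) (ν : Measure X) : Measure X :=
  ENNReal.ofReal (1 - M.γ) • Measure.sum fun t => ENNReal.ofReal (M.γ ^ t) • M.stepN π ν t

/-- The value function: the expectation of `∑ₜ γᵗ R(sₜ, aₜ)` with `s₀ = s`, `aₜ ∼ π(sₜ)` and
`sₜ₊₁ ∼ P(sₜ, aₜ)`. -/
def V (π : Kernel X Y) (s : X) : ℝ :=
  ∑' t : ℕ, M.γ ^ t * ∫ s', ∫ a, M.R s' a ∂(π s') ∂(M.stepN π (Measure.dirac s) t)

/-- The action-value function. -/
def Q (π : Kernel X Y) (s : X) (a : Y) : ℝ :=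
  M.R s a + M.γ * ∫ s', M.V π s' ∂(M.P (s, a))

/-- The advantage `A^π(s, π')` of the policy `π'` over the policy `π`. -/
def adv (π : Kernel X Y) (s : X) (π' : Kernel X Y) : ℝ :=
  ∫ a, (M.Q π s a - M.V π s) ∂(π' s)

/-- The payoff of a policy. -/
def payoff (π : Kernel X Y) : ℝ := ∫ s, M.V π s ∂M.μ

/-! ### Lipschitz and stability properties of the dynamics -/

/-- The dynamics is Wasserstein-Lipschitz in the policy, for the policies `π₁` and `π₂`. -/
def PolicyLipschitz [PseudoEMetricSpace X] [PseudoEMetricSpace Y] (π₁ π₂ : Kernel X Y)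
    (L : ℝ≥0) : Prop :=
  ∀ ν : Measure X, IsProbabilityMeasure ν →
    W (M.step π₁ ν) (M.step π₂ ν) ≤ L * policyW π₁ π₂

/-- The dynamics under the policy `π` is Wasserstein-Lipschitz in the state distribution. -/
def StateLipschitz [PseudoEMetricSpace X] (π : Kernel X Y) (L : ℝ≥0) : Prop :=
  ∀ ν₁ ν₂ : Measure X, IsProbabilityMeasure ν₁ → IsProbabilityMeasure ν₂ →
    W (M.step π ν₁) (M.step π ν₂) ≤ L * W ν₁ ν₂

/-- The expansion rate `L̃⁽ᵗ⁾` of the state distribution: the least `L ≥ 0` with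
`W(ℙ(ν₁, π₂), ℙ(ν₂, π₂)) = L W(ν₁, ν₂)`, where `νᵢ = ℙᵗ(μ, πᵢ)`. -/
def rateState [PseudoEMetricSpace X] (π₁ π₂ : Kernel X Y) (t : ℕ) : ℝ≥0∞ :=
  sInf {L | W (M.step π₂ (M.stepN π₁ M.μ t)) (M.step π₂ (M.stepN π₂ M.μ t)) =
    L * W (M.stepN π₁ M.μ t) (M.stepN π₂ M.μ t)}

/-- The expansion rate `L̂⁽ᵗ⁾` in the policy: the least `L ≥ 0` with
`W(ℙ(ν, π₁), ℙ(ν, π₂)) = L W(π₁, π₂)`, where `ν = ℙᵗ(μ, π₁)`. -/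
def ratePolicy [PseudoEMetricSpace X] [PseudoEMetricSpace Y] (π₁ π₂ : Kernel X Y) (t : ℕ) :
    ℝ≥0∞ :=
  sInf {L | W (M.step π₁ (M.stepN π₁ M.μ t)) (M.step π₂ (M.stepN π₁ M.μ t)) =
    L * policyW π₁ π₂}

/-- `C_L = sup_t ∑_{k=1}^t L̂⁽ᵗ⁻ᵏ⁾ ∏_{i=1}^{k-1} L̃⁽ᵗ⁻ⁱ⁾`. The dynamics is stable along the
two policies when this is finite. -/
def stabilityConst [PseudoEMetricSpace X] [PseudoEMetricSpace Y] (π₁ π₂ : Kernel X Y) : ℝ≥0∞ :=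
  ⨆ t : ℕ, ∑ k ∈ Finset.Icc 1 t,
    M.ratePolicy π₁ π₂ (t - k) * ∏ i ∈ Finset.Icc 1 (k - 1), M.rateState π₁ π₂ (t - i)

end MDP

/-! ### Gradients and Lipschitz constants on subsets of Euclidean spaces -/

open Classical in
/-- Extension by zero of a function on a set `D`; only used for derivatives at points of `D`
(taken within `D`, or with `D` open), so that the values off `D` play no role. -/
def zeroExt {E : Type*} (D : Set E) (f : D → ℝ) (x : E) : ℝ :=
  if h : x ∈ D then f ⟨x, h⟩ else 0

/-- `f` is differentiable on its domain `D`. -/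
def DiffOn {d : ℕ} (D : Set (EuclideanSpace ℝ (Fin d))) (f : D → ℝ) : Prop :=
  DifferentiableOn ℝ (zeroExt D f) D

/-- `Lip(f; x) = sup_x ‖∇f(x)‖₂`; the operator norm of the derivative is the Euclidean norm of
the gradient. -/
def Lip {d : ℕ} (D : Set (EuclideanSpace ℝ (Fin d))) (f : D → ℝ) : ℝ≥0∞ :=
  ⨆ x : D, ‖fderivWithin ℝ (zeroExt D f) D x‖ₑ

/-- The partial derivative `∂f/∂s⁽ʲ⁾` at a point of the open set `S`. -/
def pderiv {n : ℕ} (S : Set (EuclideanSpace ℝ (Fin n))) (f : S → ℝ) (s : S) (j : Fin n) : ℝ :=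
  fderiv ℝ (zeroExt S f) s (EuclideanSpace.single j 1)

variable {n m : ℕ} {S : Set (EuclideanSpace ℝ (Fin n))} {A : Set (EuclideanSpace ℝ (Fin m))}

/-- `‖Lip(∇ₛ q(s, a); a)‖₂`: the Euclidean norm of the vector of the Lipschitz constants in `a` of
the components of `∇ₛ q(s, a)`. -/
def lipGrad (q : S → A → ℝ) (s : S) : ℝ≥0∞ :=
  (∑ j : Fin n, Lip A (fun a => pderiv S (fun s' => q s' a) s j) ^ 2) ^ (1 / 2 : ℝ)

/-- `W((π₂(·|s') + π₁(·|s))/2, (π₂(·|s) + π₁(·|s'))/2)`. -/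
def mixW (π₁ π₂ : Kernel S A) (s s' : S) : ℝ≥0∞ :=
  W ((2⁻¹ : ℝ≥0∞) • (π₂ s' + π₁ s)) ((2⁻¹ : ℝ≥0∞) • (π₂ s + π₁ s'))

open Classical in
/-- The size of the `j`-th partial derivative of `s' ↦ mixW π₁ π₂ s s'` at `s' = s`. Since this
function is nonnegative and vanishes at `s' = s`, it typically has a kink there, and the derivative
is the limit of the quotients `mixW π₁ π₂ s (s + h eⱼ) / |h|` as `h → 0`, taken as an upper limit
so that it always makes sense in `[0, ∞]`. The value off the open set `S` plays no role. -/
def mixPartial (π₁ π₂ : Kernel S A) (s : S) (j : Fin n) : ℝ≥0∞ :=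
  limsup (fun h : ℝ =>
    if hs : (s : EuclideanSpace ℝ (Fin n)) + h • EuclideanSpace.single j 1 ∈ S then
      mixW π₁ π₂ s ⟨_, hs⟩ / ‖h‖ₑ
    else 0) (𝓝[≠] 0)

/-- `L_{G²}(π₁, π₂; s)`: the squared Euclidean norm of the gradient of `mixW π₁ π₂ s` at `s`. -/
def LG2 (π₁ π₂ : Kernel S A) (s : S) : ℝ≥0∞ :=
  ∑ j : Fin n, mixPartial π₁ π₂ s j ^ 2

/-! ### The coefficients and the lower bound -/

/-- `C₁' = sup_s 2 Lip(Q^{π₁}(s, a); a) γ L_π / ((1 - γ)(1 - γ L))`. -/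
def C₁' (M : MDP S A) (π₁ : Kernel S A) (Lπ : ℝ≥0) (L : ℝ) : ℝ≥0∞ :=
  ⨆ s, 2 * Lip A (M.Q π₁ s) * ENNReal.ofReal (M.γ * Lπ / ((1 - M.γ) * (1 - M.γ * L)))

/-- `C₂' = sup_s ‖Lip(∇ₛ Q^{π₁}(s, a); a)‖₂ γ L_π / ((1 - γ)(1 - γ L))`. -/
def C₂' (M : MDP S A) (π₁ : Kernel S A) (Lπ : ℝ≥0) (L : ℝ) : ℝ≥0∞ :=
  ⨆ s, lipGrad (M.Q π₁) s * ENNReal.ofReal (M.γ * Lπ / ((1 - M.γ) * (1 - M.γ * L)))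

/-- `C₁ = C₁' α² / 2`. -/
def C₁ (M : MDP S A) (π₁ : Kernel S A) (Lπ : ℝ≥0) (L α : ℝ) : ℝ≥0∞ :=
  C₁' M π₁ Lπ L * ENNReal.ofReal (α ^ 2 / 2)

/-- `C₂ = C₂' + C₁' / (2 α²)`. -/
def C₂ (M : MDP S A) (π₁ : Kernel S A) (Lπ : ℝ≥0) (L α : ℝ) : ℝ≥0∞ :=
  C₂' M π₁ Lπ L + C₁' M π₁ Lπ L * ENNReal.ofReal (1 / (2 * α ^ 2))

/-- The surrogate
`η_{π₁} + (1 - γ)⁻¹ E_{s ∼ ρ^{π₁}}[A^{π₁}(s, π₂)] - C₁ sup_s L_{G²} - C₂ sup_s W(π₂, π₁)²`,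
which is `-∞` when a subtracted term is infinite. -/
def surrogate (M : MDP S A) (π₁ π₂ : Kernel S A) (Lπ : ℝ≥0) (L α : ℝ) : EReal :=
  ((M.payoff π₁ + 1 / (1 - M.γ) * ∫ s, M.adv π₁ s π₂ ∂(M.visitation π₁ M.μ) : ℝ) : EReal)
    - ((C₁ M π₁ Lπ L α * ⨆ s, LG2 π₁ π₂ s : ℝ≥0∞) : EReal)
    - ((C₂ M π₁ Lπ L α * ⨆ s, W (π₂ s) (π₁ s) ^ 2 : ℝ≥0∞) : EReal)

end TDPO

end

open MeasureTheory ProbabilityTheory Filter Topology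
open scoped ENNReal NNReal

noncomputable section

namespace TDPO

/-! ### Properties of the Wasserstein distance -/

section Wasserstein

variable {X : Type*} [MeasurableSpace X]

/-! By the performance difference identity, the payoff gap `η_{π₂} - η_{π₁}` is the discounted sum
of the advantage integrated over the state laws of `π₂`. The surrogate uses the laws of `π₁`
instead, so its error is `∑ₜ γᵗ` times the difference of the two integrals at time `t`. If the
advantage is `F`-Lipschitz in the state, each difference is at most `F` times the Wasserstein
distance of the two laws, by the easy half of Kantorovich duality.

These distances start at `0`. Passing through the intermediate law "state from `π₁`, step by `π₂`"
gives a linear recursion for them. Under either dynamics assumption their discounted sum is at most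
`κ w`, where `κ = γ L_π / ((1 - γ)(1 - γ L))` and `w = sup_s W(π₂, π₁)` (`sum_pow_mul_W_le`).

For the constant `F`, the advantage is the integral of `Q(s, ·)` against `π₂(s) - π₁(s)`, and its
increments split by a product rule. Moving the policies costs `2 l` times the mixture distance, and
moving `Q` costs the action-Lipschitz constant of `∂ⱼQ` times `w`. Minkowski's inequality over the
coordinates gives `F = 2 l g + k w`, with `l`, `k`, `g²` the suprema of `Lip Q`, `lipGrad Q` and
`LG2` (`abs_adv_sub_le`). The advantage need not be differentiable: only upper limits of coordinate
difference quotients are controlled. Rademacher's theorem and an averaging argument turn them into a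
Lipschitz bound with the Euclidean constant (`abs_sub_le_of_partial_bound`).

The error is thus at most `(2 l g + k w) κ w`, and weighted AM-GM on `g w` yields the two penalties
with parameter `α`. Infinite suprema matter only when a coefficient vanishes; then the approximation
turns out to be exact. -/

lemma isProbabilityMeasure_coupling {c : Measure (X × X)} {ζ : Measure X}
    [IsProbabilityMeasure ζ] (h1 : c.map Prod.fst = ζ) : IsProbabilityMeasure c := by
  constructor
  have : c.map Prod.fst Set.univ = 1 := by rw [h1]; exact measure_univ
  rwa [Measure.map_apply measurable_fst MeasurableSet.univ, Set.preimage_univ] at this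

lemma integrable_of_bound {ζ : Measure X} [IsFiniteMeasure ζ] {g : X → ℝ} (hg : Measurable g)
    {b : ℝ} (hb : ∀ x, |g x| ≤ b) : Integrable g ζ :=
  Integrable.of_bound hg.aestronglyMeasurable b (Eventually.of_forall hb)

/-- The difference of the integrals of `g` against the marginals of a coupling. -/
lemma integral_sub_integral_eq_coupling {c : Measure (X × X)} {ζ ν : Measure X}
    [IsFiniteMeasure c] (h1 : c.map Prod.fst = ζ) (h2 : c.map Prod.snd = ν)
    {g : X → ℝ} (hg : Measurable g) {b : ℝ} (hb : ∀ x, |g x| ≤ b) :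
    ∫ x, g x ∂ζ - ∫ x, g x ∂ν = ∫ p, (g p.1 - g p.2) ∂c := by
  rw [integral_sub (f := fun p : X × X => g p.1) (g := fun p : X × X => g p.2)
    (integrable_of_bound (hg.comp measurable_fst) fun p => hb _)
    (integrable_of_bound (hg.comp measurable_snd) fun p => hb _), ← h1, ← h2,
    integral_map measurable_fst.aemeasurable hg.aestronglyMeasurable,
    integral_map measurable_snd.aemeasurable hg.aestronglyMeasurable]

variable [PseudoMetricSpace X]

lemma exists_coupling_lt {ζ ν : Measure X} {b : ℝ≥0∞} (h : W ζ ν < b) :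
    ∃ c : Measure (X × X), c.map Prod.fst = ζ ∧ c.map Prod.snd = ν ∧
      ∫⁻ p, edist p.1 p.2 ∂c < b := by
  unfold W at h
  simp only [iInf_lt_iff] at h
  obtain ⟨c, ⟨h1, h2⟩, h3⟩ := h
  exact ⟨c, h1, h2, h3⟩

lemma W_le {c : Measure (X × X)} {ζ ν : Measure X} (h1 : c.map Prod.fst = ζ)
    (h2 : c.map Prod.snd = ν) : W ζ ν ≤ ∫⁻ p, edist p.1 p.2 ∂c :=
  iInf₂_le c ⟨h1, h2⟩

variable [OpensMeasurableSpace X] [SecondCountableTopology X]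

lemma W_comm_le (ζ ν : Measure X) : W ζ ν ≤ W ν ζ := by
  refine le_iInf₂ fun c hc => ?_
  have hs : Measurable (Prod.swap : X × X → X × X) := measurable_swap
  have h1 : (c.map Prod.swap).map Prod.fst = ζ := by
    rw [Measure.map_map measurable_fst hs]; exact hc.2
  have h2 : (c.map Prod.swap).map Prod.snd = ν := by
    rw [Measure.map_map measurable_snd hs]; exact hc.1
  refine (W_le h1 h2).trans ?_
  rw [lintegral_map (by fun_prop) hs]
  simp [edist_comm]

lemma W_comm (ζ ν : Measure X) : W ζ ν = W ν ζ :=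
  le_antisymm (W_comm_le _ _) (W_comm_le _ _)

lemma W_self (ζ : Measure X) : W ζ ζ = 0 := by
  have hd : Measurable fun x : X => (x, x) := by fun_prop
  have h1 : (ζ.map fun x : X => (x, x)).map Prod.fst = ζ := by
    rw [Measure.map_map measurable_fst hd]; exact Measure.map_id
  have h2 : (ζ.map fun x : X => (x, x)).map Prod.snd = ζ := by
    rw [Measure.map_map measurable_snd hd]; exact Measure.map_id
  refine le_antisymm ((W_le h1 h2).trans ?_) bot_le
  rw [lintegral_map (by fun_prop) hd]
  simp

lemma integrable_dist_of_lintegral_edist {c : Measure (X × X)}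
    (h : ∫⁻ p, edist p.1 p.2 ∂c ≠ ⊤) : Integrable (fun p => dist p.1 p.2) c := by
  refine ⟨(by fun_prop : Measurable fun p : X × X => dist p.1 p.2).aestronglyMeasurable, ?_⟩
  rw [hasFiniteIntegral_iff_norm]
  refine lt_of_eq_of_lt (lintegral_congr fun p => ?_) h.lt_top
  rw [edist_dist, Real.norm_of_nonneg dist_nonneg]

lemma integral_dist_eq {c : Measure (X × X)} :
    ∫ p, dist p.1 p.2 ∂c = (∫⁻ p, edist p.1 p.2 ∂c).toReal := by
  rw [integral_eq_lintegral_of_nonneg_ae (Eventually.of_forall fun p => dist_nonneg)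
    (by fun_prop : Measurable fun p : X × X => dist p.1 p.2).aestronglyMeasurable]
  simp [edist_dist]

/-- The easy half of Kantorovich duality. -/
lemma abs_integral_sub_le_mul_W {ζ ν : Measure X} [IsProbabilityMeasure ζ]
    {g : X → ℝ} (hg : Measurable g) {b : ℝ} (hb : ∀ x, |g x| ≤ b) {K : ℝ} (hK : 0 ≤ K)
    (hL : ∀ x y, |g x - g y| ≤ K * dist x y) (hW : W ζ ν ≠ ⊤) :
    |∫ x, g x ∂ζ - ∫ x, g x ∂ν| ≤ K * (W ζ ν).toReal := by
  refine le_of_forall_pos_le_add fun ε hε => ?_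
  -- The infimum over couplings need not be attained, so a nearly optimal one is used; dividing by
  -- `K + 1` keeps `K` times the slack below `ε` and also covers `K = 0`.
  have hδ : 0 < ε / (K + 1) := by positivity
  obtain ⟨c, h1, h2, h3⟩ := exists_coupling_lt
    (ENNReal.lt_add_right hW (ENNReal.ofReal_pos.2 hδ).ne')
  have := isProbabilityMeasure_coupling h1
  have h3' : ∫⁻ p, edist p.1 p.2 ∂c ≠ ⊤ := h3.ne_top
  rw [integral_sub_integral_eq_coupling h1 h2 hg hb]
  have h4 : |∫ p, (g p.1 - g p.2) ∂c| ≤ ∫ p, K * dist p.1 p.2 ∂c :=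
    norm_integral_le_of_norm_le (f := fun p : X × X => g p.1 - g p.2)
      ((integrable_dist_of_lintegral_edist h3').const_mul K)
      (Eventually.of_forall fun p => hL _ _)
  rw [integral_const_mul, integral_dist_eq] at h4
  have h5 : (∫⁻ p, edist p.1 p.2 ∂c).toReal ≤ (W ζ ν).toReal + ε / (K + 1) := by
    have := ENNReal.toReal_mono (by simp [hW]) h3.le
    rwa [ENNReal.toReal_add hW ENNReal.ofReal_ne_top, ENNReal.toReal_ofReal hδ.le] at this
  calc _ ≤ _ := h4
    _ ≤ K * ((W ζ ν).toReal + ε / (K + 1)) := by gcongr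
    _ ≤ _ := by
      have : K * (ε / (K + 1)) ≤ ε := by
        rw [mul_div_assoc', div_le_iff₀ (by positivity)]; nlinarith
      linarith

/-- Thickened indicators of a closed set are bounded and Lipschitz, so duality forces equal
integrals. They decrease to the indicator of the closed set, and closed sets form a generating
π-system. -/
lemma eq_of_W_eq_zero [BorelSpace X] {ζ ν : Measure X} [IsProbabilityMeasure ζ]
    [IsProbabilityMeasure ν] (h : W ζ ν = 0) : ζ = ν := by
  have hclosed : ∀ F : Set X, IsClosed F → ζ F = ν F := by
    intro F hF
    have hpos : ∀ n : ℕ, (0 : ℝ) < 1 / (n + 1) := fun n => by positivity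
    have h0 : Tendsto (fun n : ℕ => (1 : ℝ) / (n + 1)) atTop (𝓝 0) :=
      tendsto_one_div_add_atTop_nhds_zero_nat
    have t1 := tendsto_integral_thickenedIndicator_of_isClosed ζ hF hpos h0
    have t2 := tendsto_integral_thickenedIndicator_of_isClosed ν hF hpos h0
    have heq : ∀ n : ℕ, ∫ x, (thickenedIndicator (hpos n) F x : ℝ) ∂ζ =
        ∫ x, (thickenedIndicator (hpos n) F x : ℝ) ∂ν := by
      intro n
      have hl := lipschitzWith_thickenedIndicator (hpos n) F
      have := abs_integral_sub_le_mul_W (ζ := ζ) (ν := ν)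
        (g := fun x => (thickenedIndicator (hpos n) F x : ℝ))
        (measurable_coe_nnreal_real.comp (thickenedIndicator (hpos n) F).continuous.measurable)
        (b := 1) (fun x => by
          rw [abs_of_nonneg (NNReal.coe_nonneg _)]
          exact_mod_cast thickenedIndicator_le_one (hpos n) F x)
        (NNReal.coe_nonneg _) (fun x y => by
          have := hl.dist_le_mul x y
          rwa [NNReal.dist_eq] at this) (by simp [h])
      rw [h, ENNReal.toReal_zero, mul_zero] at this
      exact sub_eq_zero.1 (abs_nonpos_iff.1 this)
    simp_rw [heq] at t1
    exact (measureReal_eq_measureReal_iff).1 (tendsto_nhds_unique t1 t2)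
  refine ext_of_generate_finite _ ?_ isPiSystem_isClosed (fun F hF => hclosed F hF) (by simp)
  rw [BorelSpace.measurable_eq (α := X), borel_eq_generateFrom_isClosed]

/-- The triangle inequality, by gluing two couplings along their common marginal. -/
lemma W_triangle [StandardBorelSpace X] (ζ ν ξ : Measure X)
    [IsProbabilityMeasure ζ] [IsProbabilityMeasure ν] :
    W ζ ξ ≤ W ζ ν + W ν ξ := by
  have : Nonempty X := nonempty_of_isProbabilityMeasure ν
  refine ENNReal.le_of_forall_pos_le_add fun ε hε hlt => ?_
  have hfin := ENNReal.add_lt_top.1 hlt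
  have hε' : ((ε / 2 : ℝ≥0) : ℝ≥0∞) ≠ 0 := by
    simp [hε.ne']
  obtain ⟨c, h1, h2, h3⟩ := exists_coupling_lt (ENNReal.lt_add_right hfin.1.ne hε')
  obtain ⟨d, k1, k2, k3⟩ := exists_coupling_lt (ENNReal.lt_add_right hfin.2.ne hε')
  have := isProbabilityMeasure_coupling h1
  have := isProbabilityMeasure_coupling k1
  -- Under `e` the pair `(x, y)` has law `c`, and `z` is drawn from the conditional law of `d` given
  -- its first coordinate `y`. This disintegration is where the standard Borel structure enters.
  set κ := Kernel.prodMkLeft X d.condKernel with hκ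
  set e := c ⊗ₘ κ with he
  have hd : d = ν ⊗ₘ d.condKernel := by
    conv_lhs => rw [← d.disintegrate d.condKernel, Measure.fst, k1]
  have hfst : e.map Prod.fst = c := by
    have := Measure.fst_compProd c κ
    rwa [Measure.fst] at this
  have hf : Measurable fun p : (X × X) × X => (p.1.2, p.2) := by fun_prop
  have hsnd : e.map (fun p => (p.1.2, p.2)) = d := by
    ext s hs
    rw [Measure.map_apply hf hs, he, Measure.compProd_apply (hf hs)]
    conv_rhs => rw [hd, Measure.compProd_apply hs, ← h2,
      lintegral_map (Kernel.measurable_kernel_prodMk_left hs) measurable_snd]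
    rfl
  have hg : Measurable fun p : (X × X) × X => (p.1.1, p.2) := by fun_prop
  have g1 : (e.map fun p => (p.1.1, p.2)).map Prod.fst = ζ := by
    rw [Measure.map_map measurable_fst hg, ← h1, ← hfst,
      Measure.map_map measurable_fst measurable_fst]
    rfl
  have g2 : (e.map fun p => (p.1.1, p.2)).map Prod.snd = ξ := by
    rw [Measure.map_map measurable_snd hg, ← k2, ← hsnd, Measure.map_map measurable_snd hf]
    rfl
  calc W ζ ξ ≤ ∫⁻ p, edist p.1 p.2 ∂(e.map fun p => (p.1.1, p.2)) := W_le g1 g2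
    _ = ∫⁻ p, edist p.1.1 p.2 ∂e := lintegral_map (by fun_prop) hg
    _ ≤ ∫⁻ p, (edist p.1.1 p.1.2 + edist p.1.2 p.2) ∂e :=
        lintegral_mono fun p => edist_triangle _ _ _
    _ = ∫⁻ p, edist p.1.1 p.1.2 ∂e + ∫⁻ p, edist p.1.2 p.2 ∂e :=
        lintegral_add_left (by fun_prop) _
    _ = ∫⁻ p, edist p.1 p.2 ∂c + ∫⁻ p, edist p.1 p.2 ∂d := by
        conv_rhs => rw [← hfst, ← hsnd, lintegral_map (by fun_prop) measurable_fst,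
          lintegral_map (by fun_prop) hf]
    _ ≤ (W ζ ν + (ε / 2 : ℝ≥0)) + (W ν ξ + (ε / 2 : ℝ≥0)) := add_le_add h3.le k3.le
    _ = W ζ ν + W ν ξ + ε := by
        rw [add_add_add_comm, ← ENNReal.coe_add, add_halves]

end Wasserstein

/-! ### Value functions and the performance difference identity -/

lemma hasSum_of_forall_eq {f g : ℕ → ℝ} {a : ℝ} (h : HasSum f a) (e : ∀ t, f t = g t) :
    HasSum g a := by
  rwa [← funext e]

lemma abs_integral_le_of_abs_le {X : Type*} [MeasurableSpace X] {ν : Measure X}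
    [IsProbabilityMeasure ν] {g : X → ℝ} {b : ℝ} (hb : ∀ x, |g x| ≤ b) : |∫ x, g x ∂ν| ≤ b := by
  have := norm_integral_le_of_norm_le_const (μ := ν) (f := g) (Eventually.of_forall hb)
  simpa using this

lemma integral_bind_kernel {X Z : Type*} [MeasurableSpace X] [MeasurableSpace Z]
    {ν : Measure X} [IsProbabilityMeasure ν] {κ : Kernel X Z} [IsMarkovKernel κ] {g : Z → ℝ}
    (hg : Measurable g) {b : ℝ} (hb : ∀ x, |g x| ≤ b) :
    ∫ z, g z ∂(ν.bind κ) = ∫ x, ∫ z, g z ∂(κ x) ∂ν := by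
  rw [Measure.comp_eq_comp_const_apply, Kernel.integral_comp (integrable_of_bound hg hb)]
  simp

namespace MDP

variable {X Y : Type*} [MeasurableSpace X] [MeasurableSpace Y] (M : MDP X Y)

instance : IsMarkovKernel M.P := M.markov

instance : IsProbabilityMeasure M.μ := M.prob

/-- The state transition kernel under the policy `π`. -/
def trans (π : Kernel X Y) : Kernel X X := M.P ∘ₖ (Kernel.id ×ₖ π)

/-- The expected immediate reward under the policy `π`. -/
def reward (π : Kernel X Y) (s : X) : ℝ := ∫ a, M.R s a ∂(π s)

variable (π : Kernel X Y)

lemma step_eq (ν : Measure X) : M.step π ν = ν.bind (M.trans π) := rfl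

lemma stepN_step (ν : Measure X) (t : ℕ) :
    M.stepN π (M.step π ν) t = M.stepN π ν (t + 1) := by
  induction t with
  | zero => rfl
  | succ t ih => rw [stepN, ih]; rfl

/-- The `t`-step transition kernel under the policy `π`. -/
def transN : ℕ → Kernel X X
  | 0 => Kernel.id
  | t + 1 => M.trans π ∘ₖ transN t

lemma stepN_eq (ν : Measure X) (t : ℕ) : M.stepN π ν t = ν.bind (M.transN π t) := by
  induction t with
  | zero => simp [stepN, transN, Measure.id_comp]
  | succ t ih => rw [stepN, transN, ih, step_eq, Measure.comp_assoc]

lemma stepN_dirac (s : X) (t : ℕ) : M.stepN π (Measure.dirac s) t = M.transN π t s := by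
  rw [stepN_eq, Measure.dirac_bind (Kernel.measurable _)]

lemma step_dirac (s : X) : M.step π (Measure.dirac s) = M.trans π s := by
  rw [step_eq, Measure.dirac_bind (Kernel.measurable _)]

lemma V_eq (s : X) : M.V π s = ∑' t : ℕ, M.γ ^ t * ∫ s', M.reward π s' ∂(M.transN π t s) := by
  simp only [V, stepN_dirac, reward]

variable [IsMarkovKernel π]

instance : IsMarkovKernel (M.trans π) := by unfold trans; infer_instance

instance (t : ℕ) : IsMarkovKernel (M.transN π t) := by
  induction t with
  | zero => unfold transN; infer_instance
  | succ t ih => unfold transN; infer_instance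

instance (ν : Measure X) [IsProbabilityMeasure ν] : IsProbabilityMeasure (M.step π ν) := by
  rw [step_eq]; infer_instance

instance (ν : Measure X) [IsProbabilityMeasure ν] (t : ℕ) :
    IsProbabilityMeasure (M.stepN π ν t) := by
  induction t with
  | zero => assumption
  | succ t ih => unfold stepN; infer_instance

lemma abs_R_le (s : X) (a : Y) : |M.R s a| ≤ M.Rmax := by
  rw [abs_of_nonneg (M.R_nonneg s a)]; exact M.R_le s a

lemma measurable_reward : Measurable (M.reward π) :=
  (StronglyMeasurable.integral_kernel_prod_right (κ := π) (f := M.R)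
    M.measurable_R.stronglyMeasurable).measurable

lemma abs_reward_le (s : X) : |M.reward π s| ≤ M.Rmax :=
  abs_integral_le_of_abs_le fun a => M.abs_R_le s a

lemma abs_pow_mul_integral_le {ν : Measure X} [IsProbabilityMeasure ν] {g : X → ℝ} {b : ℝ}
    (hb : ∀ x, |g x| ≤ b) (t : ℕ) : |M.γ ^ t * ∫ x, g x ∂ν| ≤ b * M.γ ^ t := by
  have h := pow_nonneg M.γ_nonneg t
  rw [abs_mul, abs_of_nonneg h, mul_comm]
  exact mul_le_mul_of_nonneg_right (abs_integral_le_of_abs_le hb) h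

lemma summable_mul_pow (b : ℝ) : Summable fun t : ℕ => b * M.γ ^ t :=
  (summable_geometric_of_lt_one M.γ_nonneg M.γ_lt_one).mul_left b

lemma measurable_integral_transN (t : ℕ) :
    Measurable fun s => ∫ s', M.reward π s' ∂(M.transN π t s) :=
  (StronglyMeasurable.integral_kernel (κ := M.transN π t)
    (M.measurable_reward π).stronglyMeasurable).measurable

lemma summable_V (s : X) :
    Summable fun t : ℕ => M.γ ^ t * ∫ s', M.reward π s' ∂(M.transN π t s) :=
  (M.summable_mul_pow M.Rmax).of_norm_bounded
    fun t => M.abs_pow_mul_integral_le (M.abs_reward_le π) t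

lemma measurable_V : Measurable (M.V π) := by
  have h : ∀ t : ℕ, Measurable fun s => M.γ ^ t * ∫ s', M.reward π s' ∂(M.transN π t s) :=
    fun t => (M.measurable_integral_transN π t).const_mul _
  refine measurable_of_tendsto_metrizable (f := fun (N : ℕ) s => ∑ t ∈ Finset.range N,
    M.γ ^ t * ∫ s', M.reward π s' ∂(M.transN π t s))
    (fun N => Finset.measurable_sum _ fun t _ => h t) ?_
  rw [tendsto_pi_nhds]
  intro s
  rw [V_eq]
  exact (M.summable_V π s).hasSum.tendsto_sum_nat

lemma abs_V_le (s : X) : |M.V π s| ≤ M.Rmax * (1 - M.γ)⁻¹ := by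
  rw [V_eq]
  exact tsum_of_norm_bounded
    (f := fun t : ℕ => M.γ ^ t * ∫ s', M.reward π s' ∂(M.transN π t s))
    ((hasSum_geometric_of_lt_one M.γ_nonneg M.γ_lt_one).mul_left M.Rmax)
    fun t => M.abs_pow_mul_integral_le (M.abs_reward_le π) t

lemma hasSum_integral_V (ν : Measure X) [IsProbabilityMeasure ν] :
    HasSum (fun t : ℕ => M.γ ^ t * ∫ s, M.reward π s ∂(M.stepN π ν t)) (∫ s, M.V π s ∂ν) := by
  have hb : ∀ t s, |M.γ ^ t * ∫ s', M.reward π s' ∂(M.transN π t s)| ≤ M.Rmax * M.γ ^ t :=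
    fun t s => M.abs_pow_mul_integral_le (M.abs_reward_le π) t
  have hm : ∀ t : ℕ, Measurable fun s => M.γ ^ t * ∫ s', M.reward π s' ∂(M.transN π t s) :=
    fun t => (M.measurable_integral_transN π t).const_mul _
  have := hasSum_integral_of_summable_integral_norm (μ := ν)
    (F := fun (t : ℕ) s => M.γ ^ t * ∫ s', M.reward π s' ∂(M.transN π t s))
    (fun t => integrable_of_bound (hm t) (hb t)) ?_
  · simp_rw [← V_eq, integral_const_mul] at this
    refine hasSum_of_forall_eq this fun t => ?_
    rw [stepN_eq, integral_bind_kernel (M.measurable_reward π) (M.abs_reward_le π)]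
  · refine (M.summable_mul_pow M.Rmax).of_norm_bounded fun t => ?_
    exact abs_integral_le_of_abs_le fun s => by
      rw [abs_of_nonneg (norm_nonneg _)]; exact hb t s

/-- The reward series started from `M.step π ν` is the series from `ν` shifted by one; splitting off
the term `t = 0` gives the Bellman equation in integrated form. -/
lemma integral_V_eq (ν : Measure X) [IsProbabilityMeasure ν] :
    ∫ s, M.V π s ∂ν = ∫ s, M.reward π s ∂ν + M.γ * ∫ s, M.V π s ∂(M.step π ν) := by
  have h1 := M.hasSum_integral_V π ν
  have h2 := (M.hasSum_integral_V π (M.step π ν)).mul_left M.γ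
  simp_rw [stepN_step, ← mul_assoc, ← pow_succ'] at h2
  have h3 := h1.unique (HasSum.zero_add
    (f := fun t : ℕ => M.γ ^ t * ∫ s, M.reward π s ∂(M.stepN π ν t)) h2)
  simpa [stepN] using h3

/-- The Bellman equation. -/
lemma V_eq_add (s : X) : M.V π s = M.reward π s + M.γ * ∫ s', M.V π s' ∂(M.trans π s) := by
  have h := M.integral_V_eq π (Measure.dirac s)
  rwa [integral_dirac' _ _ (M.measurable_V π).stronglyMeasurable,
    integral_dirac' _ _ (M.measurable_reward π).stronglyMeasurable, step_dirac] at h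

lemma measurable_Q : Measurable fun p : X × Y => M.Q π p.1 p.2 := by
  refine M.measurable_R.add (Measurable.const_mul ?_ _)
  exact (StronglyMeasurable.integral_kernel (κ := M.P)
    (M.measurable_V π).stronglyMeasurable).measurable

lemma measurable_Q_right (s : X) : Measurable (M.Q π s) :=
  (M.measurable_Q π).comp measurable_prodMk_left

lemma abs_Q_le (s : X) (a : Y) :
    |M.Q π s a| ≤ M.Rmax + M.γ * (M.Rmax * (1 - M.γ)⁻¹) := by
  refine (abs_add_le _ _).trans (add_le_add (M.abs_R_le s a) ?_)
  rw [abs_mul, abs_of_nonneg M.γ_nonneg]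
  exact mul_le_mul_of_nonneg_left (abs_integral_le_of_abs_le (M.abs_V_le π)) M.γ_nonneg

variable (π' : Kernel X Y) [IsMarkovKernel π']

lemma trans_apply (s : X) : M.trans π s = (π s).bind (M.P.comap (fun a => (s, a))
    measurable_prodMk_left) := by
  rw [trans, Kernel.comp_apply, Kernel.prod_apply, Kernel.id_apply, Measure.dirac_prod]
  ext t ht
  rw [Measure.bind_apply ht (Kernel.aemeasurable _), Measure.bind_apply ht (Kernel.aemeasurable _),
    lintegral_map (Kernel.measurable_coe _ ht) measurable_prodMk_left]
  rfl

lemma integral_Q_eq (s : X) :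
    ∫ a, M.Q π s a ∂(π' s) = M.reward π' s + M.γ * ∫ s', M.V π s' ∂(M.trans π' s) := by
  have hP : Measurable fun a => ∫ s', M.V π s' ∂(M.P (s, a)) :=
    ((StronglyMeasurable.integral_kernel (κ := M.P)
      (M.measurable_V π).stronglyMeasurable).measurable).comp measurable_prodMk_left
  have hR : Measurable (M.R s) := M.measurable_R.comp measurable_prodMk_left
  unfold Q
  rw [integral_add (integrable_of_bound hR (M.abs_R_le s))
    ((integrable_of_bound hP fun a => abs_integral_le_of_abs_le (M.abs_V_le π)).const_mul _),
    integral_const_mul, trans_apply, integral_bind_kernel (M.measurable_V π) (M.abs_V_le π)]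
  rfl

lemma adv_eq_sub_V (s : X) : M.adv π s π' = ∫ a, M.Q π s a ∂(π' s) - M.V π s := by
  rw [adv, integral_sub (integrable_of_bound (M.measurable_Q_right π s) (M.abs_Q_le π s))
    (integrable_const _)]
  simp

/-- By the Bellman equation, `V` is the mean of `Q` under `π` itself. In this form the advantage
compares two measures on one integrand, which is what a Wasserstein distance can bound. -/
lemma adv_eq (s : X) :
    M.adv π s π' = ∫ a, M.Q π s a ∂(π' s) - ∫ a, M.Q π s a ∂(π s) := by
  rw [adv_eq_sub_V, integral_Q_eq M π π, ← V_eq_add]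

lemma measurable_adv : Measurable fun s => M.adv π s π' := by
  simp_rw [adv_eq_sub_V]
  exact (StronglyMeasurable.integral_kernel_prod_right (κ := π') (f := M.Q π)
    (M.measurable_Q π).stronglyMeasurable).measurable.sub (M.measurable_V π)

/-- A uniform bound of the advantage. -/
def advBound : ℝ :=
  (M.Rmax + M.γ * (M.Rmax * (1 - M.γ)⁻¹)) + (M.Rmax + M.γ * (M.Rmax * (1 - M.γ)⁻¹))

lemma abs_adv_le (s : X) : |M.adv π s π'| ≤ M.advBound := by
  rw [adv_eq]
  exact (abs_sub _ _).trans (add_le_add (abs_integral_le_of_abs_le (M.abs_Q_le π s))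
    (abs_integral_le_of_abs_le (M.abs_Q_le π s)))

lemma integral_adv_eq (ν : Measure X) [IsProbabilityMeasure ν] :
    ∫ s, M.adv π s π' ∂ν = ∫ s, M.reward π' s ∂ν + M.γ * ∫ s, M.V π s ∂(M.step π' ν)
      - ∫ s, M.V π s ∂ν := by
  have hm : Measurable fun s => ∫ s', M.V π s' ∂(M.trans π' s) :=
    (StronglyMeasurable.integral_kernel (κ := M.trans π')
      (M.measurable_V π).stronglyMeasurable).measurable
  have hi := integrable_of_bound (ζ := ν) hm
    fun s => abs_integral_le_of_abs_le (ν := M.trans π' s) (M.abs_V_le π)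
  have hr := integrable_of_bound (ζ := ν) (M.measurable_reward π') (M.abs_reward_le π')
  simp_rw [adv_eq_sub_V, integral_Q_eq]
  rw [integral_sub (f := fun s => M.reward π' s + M.γ * ∫ s', M.V π s' ∂(M.trans π' s))
    (hr.add (hi.const_mul _))
    (integrable_of_bound (M.measurable_V π) (M.abs_V_le π)),
    integral_add hr (hi.const_mul _), integral_const_mul, step_eq,
    integral_bind_kernel (M.measurable_V π) (M.abs_V_le π)]

/-- The performance difference identity. -/
lemma hasSum_payoff_sub :
    HasSum (fun t : ℕ => M.γ ^ t * ∫ s, M.adv π s π' ∂(M.stepN π' M.μ t))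
      (M.payoff π' - M.payoff π) := by
  have h1 := M.hasSum_integral_V π' M.μ
  set v : ℕ → ℝ := fun t => M.γ ^ t * ∫ s, M.V π s ∂(M.stepN π' M.μ t) with hv
  have hvs : Summable v := (M.summable_mul_pow _).of_norm_bounded
    fun t => M.abs_pow_mul_integral_le (M.abs_V_le π) t
  -- Integrated over the law at time `t`, the discounted advantage is the discounted reward of `π'`
  -- plus `v (t + 1) - v t`. The latter telescopes to `-v 0`, minus the payoff of `π`.
  have h2 : HasSum (fun t => v (t + 1) - v t) (-v 0) := by
    have := ((hasSum_nat_add_iff' 1).2 hvs.hasSum).sub hvs.hasSum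
    simpa using this
  have h3 := h1.add h2
  have h0 : v 0 = M.payoff π := by simp [hv, payoff, stepN]
  rw [h0] at h3
  rw [← sub_eq_add_neg] at h3
  refine hasSum_of_forall_eq h3 fun t => ?_
  rw [integral_adv_eq, hv]
  simp only [stepN]
  ring

lemma hasSum_integral_visitation {g : X → ℝ} (hg : Measurable g) {b : ℝ} (hb : ∀ s, |g s| ≤ b) :
    HasSum (fun t : ℕ => M.γ ^ t * ∫ s, g s ∂(M.stepN π M.μ t))
      (1 / (1 - M.γ) * ∫ s, g s ∂(M.visitation π M.μ)) := by
  have hγ : 0 < 1 - M.γ := sub_pos.2 M.γ_lt_one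
  have hint : Integrable g (Measure.sum fun t => ENNReal.ofReal (M.γ ^ t) • M.stepN π M.μ t) := by
    refine integrable_sum_measure
      (fun t => (integrable_of_bound hg hb).smul_measure ENNReal.ofReal_ne_top) ?_
    refine (M.summable_mul_pow b).of_norm_bounded fun t => ?_
    rw [integral_smul_measure, ENNReal.toReal_ofReal (pow_nonneg M.γ_nonneg t), smul_eq_mul]
    exact M.abs_pow_mul_integral_le (fun s => by
      rw [abs_of_nonneg (norm_nonneg _)]; exact hb s) t
  have h := hasSum_integral_measure hint
  rw [visitation, integral_smul_measure, ENNReal.toReal_ofReal hγ.le, smul_eq_mul, ← mul_assoc,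
    one_div, inv_mul_cancel₀ hγ.ne', one_mul]
  refine hasSum_of_forall_eq h fun t => ?_
  rw [integral_smul_measure, ENNReal.toReal_ofReal (pow_nonneg M.γ_nonneg t), smul_eq_mul]

/-- The error of the first-order approximation of the payoff at the policy `π`. -/
lemma hasSum_payoff_sub_approx :
    HasSum (fun t : ℕ => M.γ ^ t * (∫ s, M.adv π s π' ∂(M.stepN π' M.μ t)
        - ∫ s, M.adv π s π' ∂(M.stepN π M.μ t)))
      (M.payoff π' - (M.payoff π + 1 / (1 - M.γ) *
        ∫ s, M.adv π s π' ∂(M.visitation π M.μ))) := by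
  have h := (M.hasSum_payoff_sub π π').sub
    (M.hasSum_integral_visitation π (M.measurable_adv π π') (M.abs_adv_le π π'))
  rw [sub_sub] at h
  refine hasSum_of_forall_eq h fun t => ?_
  ring

end MDP

/-! ### Lipschitz bounds from bounds of the partial difference quotients -/

section Analysis

/-- A mean value inequality for the upper limits of the absolute difference quotients. -/
lemma abs_sub_le_of_eventually_abs_sub_le {g : ℝ → ℝ} {a b C : ℝ} (hab : a ≤ b)
    (h : ∀ t ∈ Set.Icc a b, ∀ ε > 0, ∀ᶠ u in 𝓝[Set.Icc a b] t, |g u - g t| ≤ (C + ε) * |u - t|) :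
    |g b - g a| ≤ C * (b - a) := by
  have hcont : ContinuousOn g (Set.Icc a b) := by
    intro t ht
    rw [ContinuousWithinAt, tendsto_iff_norm_sub_tendsto_zero]
    refine squeeze_zero' (Eventually.of_forall fun u => norm_nonneg _) (h t ht 1 one_pos) ?_
    have hc : Continuous fun u : ℝ => (C + 1) * |u - t| := by fun_prop
    have h0 := (hc.tendsto t).mono_left (nhdsWithin_le_nhds (s := Set.Icc a b))
    simpa using h0
  have hkey : ∀ ε > 0, |g b - g a| ≤ (C + ε) * (b - a) := by
    intro ε hε
    -- Fencing argument: the upper slopes of `|g - g a|` are at most `C`, strictly below the slope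
    -- `C + ε` of the barrier, so the barrier is never crossed. No derivative of `g` is needed.
    refine image_norm_le_of_liminf_right_slope_norm_lt_deriv_boundary (a := a) (b := b)
      (f := fun t => g t - g a) (f' := fun _ => C) (B := fun t => (C + ε) * (t - a))
      (B' := fun _ => C + ε) (hcont.sub continuousOn_const) ?_ (by simp) (by fun_prop) ?_
      (fun _ _ _ => by linarith) (Set.right_mem_Icc.2 hab)
    · intro x hx r hr
      have hle : 𝓝[>] x ≤ 𝓝[Set.Icc a b] x := by
        rw [← nhdsWithin_Ioc_eq_nhdsGT hx.2]
        exact nhdsWithin_mono _ fun z hz => ⟨hx.1.trans hz.1.le, hz.2⟩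
      have he := hle (h x ⟨hx.1, hx.2.le⟩ ((r - C) / 2) (by linarith))
      refine Eventually.frequently ?_
      filter_upwards [he, self_mem_nhdsWithin] with z hz hxz
      have hxz' : 0 < z - x := sub_pos.2 hxz
      rw [slope_def_field, div_lt_iff₀ hxz']
      have h1 : |g z - g a| - |g x - g a| ≤ |g z - g x| := by
        have := abs_sub_abs_le_abs_sub (g z - g a) (g x - g a)
        rwa [sub_sub_sub_cancel_right] at this
      rw [abs_of_pos hxz'] at hz
      have h2 : (C + (r - C) / 2) * (z - x) < r * (z - x) :=
        mul_lt_mul_of_pos_right (by linarith) hxz'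
      exact (h1.trans hz).trans_lt h2
    · intro x _
      have := ((hasDerivAt_id x).sub_const a).const_mul (C + ε)
      simpa using this.hasDerivWithinAt
  refine le_of_forall_pos_le_add fun ε hε => ?_
  have h1 := hkey (ε / (b - a + 1)) (by have := sub_nonneg.2 hab; positivity)
  have h2 : ε / (b - a + 1) * (b - a) ≤ ε := by
    have := sub_nonneg.2 hab
    rw [div_mul_eq_mul_div, div_le_iff₀ (by positivity)]
    nlinarith
  linarith

lemma abs_sub_le_of_directional_bound {E : Type*} [NormedAddCommGroup E] [NormedSpace ℝ E]
    {S : Set E} (hS : Convex ℝ S) {f : E → ℝ} {x y : E} (hx : x ∈ S) (hy : y ∈ S) {C : ℝ}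
    (h : ∀ s ∈ S, ∀ ε > 0, ∀ᶠ t in 𝓝 (0 : ℝ),
      |f (s + t • (y - x)) - f s| ≤ (C + ε) * |t|) : |f y - f x| ≤ C := by
  have := abs_sub_le_of_eventually_abs_sub_le (C := C)
    (g := fun t : ℝ => f (x + t • (y - x)))
    zero_le_one ?_
  · simpa using this
  intro t ht ε hε
  have hs : x + t • (y - x) ∈ S := hS.add_smul_sub_mem hx hy ht
  have hc : Tendsto (fun u : ℝ => u - t) (𝓝[Set.Icc 0 1] t) (𝓝 0) := by
    have : Continuous fun u : ℝ => u - t := by fun_prop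
    have h0 := (this.tendsto t).mono_left (nhdsWithin_le_nhds (s := Set.Icc (0 : ℝ) 1))
    simpa using h0
  filter_upwards [hc.eventually (h _ hs ε hε)] with u hu
  have e : x + t • (y - x) + (u - t) • (y - x) = x + u • (y - x) := by module
  rwa [e] at hu

/-- A Lipschitz function whose derivative is bounded by `F` almost everywhere on an open convex
set is `F`-Lipschitz there. -/
lemma LipschitzWith.abs_sub_le_of_ae_fderiv_le {E : Type*} [NormedAddCommGroup E]
    [NormedSpace ℝ E] [FiniteDimensional ℝ E] [MeasureSpace E] [BorelSpace E]
    [(volume : Measure E).IsAddHaarMeasure] {f : E → ℝ} {K : ℝ≥0} (hf : LipschitzWith K f)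
    {U : Set E} (hU : IsOpen U) (hUc : Convex ℝ U) {F : ℝ}
    (hd : ∀ᵐ s : E, s ∈ U → ∀ v, |fderiv ℝ f s v| ≤ F * ‖v‖) {x y : E} (hx : x ∈ U) (hy : y ∈ U) :
    |f y - f x| ≤ F * ‖y - x‖ := by
  set v := y - x with hv
  obtain ⟨δ₁, hδ₁, hb₁⟩ := Metric.isOpen_iff.1 hU x hx
  obtain ⟨δ₂, hδ₂, hb₂⟩ := Metric.isOpen_iff.1 hU y hy
  have hmem : ∀ δ, δ ≤ min δ₁ δ₂ → ∀ z ∈ Metric.ball (0 : E) δ, ∀ t ∈ Set.Icc (0 : ℝ) 1,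
      x + t • v + z ∈ U := by
    intro δ hδ z hz t ht
    have hz' : ‖z‖ < δ := by simpa using hz
    have h1 : x + z ∈ U := hb₁ (by
      rw [Metric.mem_ball, dist_eq_norm, add_sub_cancel_left]
      exact hz'.trans_le (hδ.trans (min_le_left _ _)))
    have h2 : y + z ∈ U := hb₂ (by
      rw [Metric.mem_ball, dist_eq_norm, add_sub_cancel_left]
      exact hz'.trans_le (hδ.trans (min_le_right _ _)))
    have := hUc.add_smul_sub_mem h1 h2 ht
    convert this using 1
    rw [hv]; module
  -- The segment from `x` to `y` may lie entirely in the exceptional null set. Averaging over its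
  -- translates by a small ball avoids this: for each `t`, almost every translated point is good,
  -- and the averaged function is differentiable in `t` by dominated convergence.
  have hkey : ∀ δ, 0 < δ → δ ≤ min δ₁ δ₂ → |f y - f x| ≤ F * ‖v‖ + 2 * K * δ := by
    intro δ hδ hδ'
    set B := Metric.ball (0 : E) δ with hB
    set m := (volume : Measure E).restrict B with hm
    have : IsFiniteMeasure m := ⟨by rw [hm, Measure.restrict_apply_univ]; exact measure_ball_lt_top⟩
    set c := m.real Set.univ with hc
    have hc0 : 0 < c := by
      rw [hc, measureReal_def, hm, Measure.restrict_apply_univ]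
      exact ENNReal.toReal_pos (Metric.measure_ball_pos _ _ hδ).ne' measure_ball_lt_top.ne
    have hint : ∀ w : E, Integrable (fun z => f (w + z)) m := by
      intro w
      have hcont : Continuous fun z => f (w + z) := hf.continuous.comp (by fun_prop)
      exact (hcont.continuousOn.integrableOn_compact (isCompact_closedBall (0 : E) δ)).mono_set
        Metric.ball_subset_closedBall
    have hder : ∀ t ∈ Set.Icc (0 : ℝ) 1, HasDerivAt (fun t => ∫ z, f (x + t • v + z) ∂m)
        (∫ z, fderiv ℝ f (x + t • v + z) v ∂m) t := by
      intro t _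
      refine (hasDerivAt_integral_of_dominated_loc_of_lip (bound := fun _ => K * ‖v‖)
        (F' := fun z => fderiv ℝ f (x + t • v + z) v) univ_mem
        (Eventually.of_forall fun u => (hint _).aestronglyMeasurable) (hint _) ?_ ?_
        (integrable_const _) ?_).2
      · exact ((measurable_fderiv_apply_const ℝ f v).comp
          (measurable_const_add _)).aestronglyMeasurable
      · refine Eventually.of_forall fun z => LipschitzOnWith.of_dist_le_mul fun u _ w _ => ?_
        rw [Real.coe_nnabs, abs_of_nonneg (by positivity)]
        refine (hf.dist_le_mul _ _).trans ?_
        rw [dist_add_right, dist_add_left, dist_eq_norm, ← sub_smul, norm_smul, dist_eq_norm]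
        exact le_of_eq (by ring)
      · have hae : ∀ᵐ z : E, DifferentiableAt ℝ f (x + t • v + z) :=
          (measurePreserving_add_left volume (x + t • v)).quasiMeasurePreserving.ae
            hf.ae_differentiableAt
        filter_upwards [ae_restrict_of_ae hae] with z hz
        have h1 : HasDerivAt (fun u : ℝ => x + u • v + z) v t := by
          simpa using (((hasDerivAt_id t).smul_const v).const_add x).add_const z
        exact hz.hasFDerivAt.comp_hasDerivAt t h1
    have hbound : ∀ t ∈ Set.Ico (0 : ℝ) 1, ‖∫ z, fderiv ℝ f (x + t • v + z) v ∂m‖ ≤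
        F * ‖v‖ * c := by
      intro t ht
      refine norm_integral_le_of_norm_le_const ?_
      have hae := (measurePreserving_add_left volume (x + t • v)).quasiMeasurePreserving.ae hd
      filter_upwards [ae_restrict_of_ae hae, ae_restrict_mem measurableSet_ball] with z hz hzB
      exact hz (hmem δ hδ' z hzB t ⟨ht.1, ht.2.le⟩) v
    have hmv := norm_image_sub_le_of_norm_deriv_le_segment_01'
      (fun t ht => (hder t ht).hasDerivWithinAt) hbound
    have e1 : x + (1 : ℝ) • v = y := by rw [hv]; module
    have e0 : x + (0 : ℝ) • v = x := by module
    rw [e1, e0, ← integral_sub (hint y) (hint x)] at hmv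
    -- Replacing the averages by the values at the endpoints costs at most `K δ` at each end.
    have hdiff : ‖∫ z, ((f y - f x) - (f (y + z) - f (x + z))) ∂m‖ ≤ 2 * K * δ * c := by
      refine norm_integral_le_of_norm_le_const ?_
      filter_upwards [ae_restrict_mem measurableSet_ball] with z hzB
      have hz' : ‖z‖ ≤ δ := by
        have : ‖z‖ < δ := by simpa [hB] using hzB
        exact this.le
      have a1 := hf.dist_le_mul y (y + z)
      have a2 := hf.dist_le_mul x (x + z)
      rw [dist_self_add_right, Real.dist_eq] at a1 a2
      have a3 : (K : ℝ) * ‖z‖ ≤ K * δ := by gcongr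
      rw [Real.norm_eq_abs, sub_sub_sub_comm]
      refine (abs_sub _ _).trans ?_
      linarith
    rw [integral_sub (g := fun z => f (y + z) - f (x + z)) (integrable_const _)
      ((hint y).sub (hint x)), integral_const, smul_eq_mul, ← hc, Real.norm_eq_abs] at hdiff
    rw [Real.norm_eq_abs] at hmv
    have h3 : c * |f y - f x| ≤ c * (F * ‖v‖ + 2 * K * δ) := by
      rw [← abs_of_pos hc0, ← abs_mul, abs_of_pos hc0]
      have := abs_sub_abs_le_abs_sub (c * (f y - f x)) (∫ z, (f (y + z) - f (x + z)) ∂m)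
      linarith
    exact le_of_mul_le_mul_left h3 hc0
  have hlim : Tendsto (fun δ : ℝ => F * ‖v‖ + 2 * K * δ) (𝓝[>] 0) (𝓝 (F * ‖v‖)) := by
    have hc : Continuous fun δ : ℝ => F * ‖v‖ + 2 * K * δ := by fun_prop
    have h0 := (hc.tendsto 0).mono_left (nhdsWithin_le_nhds (s := Set.Ioi (0 : ℝ)))
    simpa using h0
  refine ge_of_tendsto hlim ?_
  filter_upwards [Ioc_mem_nhdsGT (lt_min hδ₁ hδ₂)] with δ hδ
  exact hkey δ hδ.1 hδ.2

variable {n : ℕ}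

lemma abs_clm_apply_le {l : EuclideanSpace ℝ (Fin n) →L[ℝ] ℝ} {D : Fin n → ℝ} {F : ℝ}
    (hF : 0 ≤ F) (hD : ∑ j, D j ^ 2 ≤ F ^ 2)
    (hl : ∀ j, |l (EuclideanSpace.single j 1)| ≤ D j) (v : EuclideanSpace ℝ (Fin n)) :
    |l v| ≤ F * ‖v‖ := by
  have hv : v = ∑ j, v j • EuclideanSpace.single j (1 : ℝ) := by
    ext i
    simp [Pi.single_apply]
  have h1 : |l v| ≤ ∑ j, D j * |v j| := by
    conv_lhs => rw [hv, map_sum]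
    refine (Finset.abs_sum_le_sum_abs _ _).trans (Finset.sum_le_sum fun j _ => ?_)
    rw [map_smul, smul_eq_mul, abs_mul, mul_comm]
    exact mul_le_mul_of_nonneg_right (hl j) (abs_nonneg _)
  have h2 := Finset.sum_mul_sq_le_sq_mul_sq Finset.univ D (fun j => |v j|)
  have h3 : ∑ j, |v j| ^ 2 = ‖v‖ ^ 2 := by
    rw [EuclideanSpace.norm_sq_eq]; simp
  rw [h3] at h2
  refine h1.trans (abs_le_of_sq_le_sq' ?_ (by positivity)).2
  calc _ ≤ _ := h2
    _ ≤ F ^ 2 * ‖v‖ ^ 2 := by gcongr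
    _ = _ := by ring

/-- If the steps in the coordinate directions satisfy a Lipschitz bound on a ball, then the
function is Lipschitz on the ball of half the radius. -/
lemma abs_sub_le_of_coordinate_bound {f : EuclideanSpace ℝ (Fin n) → ℝ}
    {x : EuclideanSpace ℝ (Fin n)} {r F : ℝ} (hF : 0 ≤ F)
    (h : ∀ s ∈ Metric.ball x r, ∀ (j : Fin n) (c : ℝ),
      s + c • EuclideanSpace.single j 1 ∈ Metric.ball x r →
        |f (s + c • EuclideanSpace.single j 1) - f s| ≤ F * |c|)
    {y z : EuclideanSpace ℝ (Fin n)} (hy : y ∈ Metric.ball x (r / 2))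
    (hz : z ∈ Metric.ball x (r / 2)) : |f z - f y| ≤ n * F * ‖z - y‖ := by
  classical
  -- Coordinates of `y` are replaced by those of `z` one at a time; `w J` is the point at which
  -- those in `J` have been replaced.
  set w : Finset (Fin n) → EuclideanSpace ℝ (Fin n) := fun J =>
    y + ∑ j ∈ J, (z j - y j) • EuclideanSpace.single j (1 : ℝ) with hw
  have hwi : ∀ J i, w J i = if i ∈ J then z i else y i := by
    intro J i
    have : ∀ j, ((z j - y j) • EuclideanSpace.single j (1 : ℝ)) i =
        if i = j then z j - y j else 0 := by
      intro j
      simp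
    simp only [hw, PiLp.add_apply, WithLp.ofLp_sum, Finset.sum_apply, this, Finset.sum_ite_eq]
    split_ifs <;> ring
  have hball : ∀ J, w J ∈ Metric.ball x r := by
    intro J
    rw [Metric.mem_ball, dist_eq_norm] at hy hz ⊢
    have hr : 0 < r := by have := (norm_nonneg _).trans_lt hy; linarith
    refine lt_of_pow_lt_pow_left₀ 2 hr.le ?_
    -- Each coordinate of `w J - x` comes from `y - x` or from `z - x`, so the squared norm is at
    -- most `2 (r / 2)² < r²`. Hence half the radius suffices.
    have h1 : ‖w J - x‖ ^ 2 ≤ ‖y - x‖ ^ 2 + ‖z - x‖ ^ 2 := by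
      simp only [EuclideanSpace.norm_sq_eq, ← Finset.sum_add_distrib]
      refine Finset.sum_le_sum fun i _ => ?_
      simp only [PiLp.sub_apply, hwi]
      split_ifs
      · have := sq_nonneg ‖y i - x i‖; linarith
      · have := sq_nonneg ‖z i - x i‖; linarith
    have h2 : ‖y - x‖ ^ 2 ≤ (r / 2) ^ 2 := by gcongr
    have h3 : ‖z - x‖ ^ 2 ≤ (r / 2) ^ 2 := by gcongr
    nlinarith
  have hsum : ∀ J, |f (w J) - f y| ≤ ∑ _j ∈ J, F * ‖z - y‖ := by
    intro J
    induction J using Finset.induction_on with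
    | empty => simp [hw]
    | insert j J hj ih =>
      have e : w (insert j J) = w J + (z j - y j) • EuclideanSpace.single j 1 := by
        simp only [hw, Finset.sum_insert hj]; abel
      have h1 := h (w J) (hball J) j (z j - y j) (e ▸ hball _)
      rw [← e] at h1
      have h2 : |z j - y j| ≤ ‖z - y‖ := PiLp.norm_apply_le (z - y) j
      rw [Finset.sum_insert hj]
      calc _ ≤ |f (w (insert j J)) - f (w J)| + |f (w J) - f y| := abs_sub_le _ _ _
        _ ≤ F * ‖z - y‖ + _ := add_le_add (h1.trans (by gcongr)) ih
  have := hsum Finset.univ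
  have e : w Finset.univ = z := by ext i; simp [hwi]
  rw [e] at this
  simpa [mul_assoc] using this

/-- If the upper limits of the absolute difference quotients in the coordinate directions are
bounded by `D s j` with `‖D s‖₂ ≤ F` at every point `s` of an open convex set, then the function
is `F`-Lipschitz there. -/
lemma abs_sub_le_of_partial_bound {S : Set (EuclideanSpace ℝ (Fin n))} (hS : IsOpen S)
    (hSc : Convex ℝ S) {f : EuclideanSpace ℝ (Fin n) → ℝ}
    {D : EuclideanSpace ℝ (Fin n) → Fin n → ℝ} {F : ℝ} (hF : 0 ≤ F)
    (hD0 : ∀ s ∈ S, ∀ j, 0 ≤ D s j) (hD : ∀ s ∈ S, ∑ j, D s j ^ 2 ≤ F ^ 2)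
    (h : ∀ s ∈ S, ∀ j, ∀ ε > 0, ∀ᶠ t in 𝓝 (0 : ℝ),
      |f (s + t • EuclideanSpace.single j 1) - f s| ≤ (D s j + ε) * |t|)
    {x y : EuclideanSpace ℝ (Fin n)} (hx : x ∈ S) (hy : y ∈ S) :
    |f y - f x| ≤ F * ‖y - x‖ := by
  have hDF : ∀ s ∈ S, ∀ j, D s j ≤ F := fun s hs j => by
    refine (abs_le_of_sq_le_sq' ?_ hF).2
    exact (Finset.single_le_sum (f := fun j => D s j ^ 2) (fun i _ => sq_nonneg _)
      (Finset.mem_univ j)).trans (hD s hs)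
  have hcoord : ∀ x ∈ S, ∀ (j : Fin n) (c : ℝ), x + c • EuclideanSpace.single j 1 ∈ S →
      |f (x + c • EuclideanSpace.single j 1) - f x| ≤ F * |c| := by
    intro x hx j c hxc
    refine abs_sub_le_of_directional_bound hSc hx hxc fun s hs ε hε => ?_
    have hc : Tendsto (fun t : ℝ => t * c) (𝓝 0) (𝓝 0) := by
      have : Continuous fun t : ℝ => t * c := by fun_prop
      simpa using this.tendsto 0
    have hε' : 0 < ε / (|c| + 1) := by positivity
    filter_upwards [hc.eventually (h s hs j _ hε')] with t ht
    rw [add_sub_cancel_left, smul_smul]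
    refine ht.trans ?_
    rw [abs_mul]
    have h1 : (D s j + ε / (|c| + 1)) * |c| ≤ F * |c| + ε := by
      have h2 : ε / (|c| + 1) * |c| ≤ ε := by
        rw [div_mul_eq_mul_div, div_le_iff₀ (by positivity)]
        nlinarith [abs_nonneg c]
      have h3 := mul_le_mul_of_nonneg_right (hDF s hs j) (abs_nonneg c)
      linarith
    calc _ = (D s j + ε / (|c| + 1)) * |c| * |t| := by ring
      _ ≤ _ := mul_le_mul_of_nonneg_right h1 (abs_nonneg t)
  -- The coordinate bounds give a local Lipschitz property with the crude constant `n F`, enough for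
  -- Rademacher's theorem on a global Lipschitz extension. At points of differentiability the
  -- partial derivatives are at most `D s j`, so the gradient norm is at most `F`, and the crude
  -- constant improves to `F`.
  have hlocal : ∀ x ∈ S, ∃ r > 0, ∀ y ∈ Metric.ball x r, |f y - f x| ≤ F * ‖y - x‖ := by
    intro x hx
    obtain ⟨r, hr, hrS⟩ := Metric.isOpen_iff.1 hS x hx
    have hlip : LipschitzOnWith (Real.toNNReal (n * F)) f (Metric.ball x (r / 2)) := by
      refine LipschitzOnWith.of_dist_le_mul fun y hy z hz => ?_
      rw [Real.coe_toNNReal _ (by positivity), Real.dist_eq, dist_eq_norm]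
      exact abs_sub_le_of_coordinate_bound hF
        (fun s hs j c hc => hcoord s (hrS hs) j c (hrS hc)) hz hy
    obtain ⟨g, hg, hfg⟩ := hlip.extend_real
    refine ⟨r / 2, by positivity, fun y hy => ?_⟩
    have hx' : x ∈ Metric.ball x (r / 2) := Metric.mem_ball_self (by positivity)
    rw [hfg hy, hfg hx']
    refine LipschitzWith.abs_sub_le_of_ae_fderiv_le hg Metric.isOpen_ball (convex_ball _ _)
      ?_ hx' hy
    filter_upwards [hg.ae_differentiableAt] with s hs hsU
    have hsS : s ∈ S := hrS (Metric.ball_subset_ball (by linarith) hsU)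
    refine abs_clm_apply_le hF (hD s hsS) fun j => le_of_forall_pos_le_add fun ε hε => ?_
    have hline : HasDerivAt (fun t : ℝ => s + t • EuclideanSpace.single j (1 : ℝ))
        (EuclideanSpace.single j (1 : ℝ)) 0 := by
      simpa using ((hasDerivAt_id (0 : ℝ)).smul_const
        (EuclideanSpace.single j (1 : ℝ))).const_add s
    have hs0 : s + (0 : ℝ) • EuclideanSpace.single j (1 : ℝ) = s := by simp
    have hcomp := HasFDerivAt.comp_hasDerivAt (0 : ℝ) (hs0.symm ▸ hs.hasFDerivAt) hline
    have hnear : ∀ᶠ t in 𝓝 (0 : ℝ),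
        s + t • EuclideanSpace.single j (1 : ℝ) ∈ Metric.ball x (r / 2) :=
      hline.continuousAt.eventually_mem (by
        rw [hs0]; exact Metric.isOpen_ball.mem_nhds hsU)
    rw [hs0] at hcomp
    refine hcomp.le_of_lip' (add_nonneg (hD0 s hsS j) hε.le) ?_
    filter_upwards [h s hsS j ε hε, hnear] with t ht htU
    simp only [Function.comp_apply, hs0, sub_zero]
    rw [← hfg htU, ← hfg hsU]
    exact ht
  -- The local estimate is propagated along the segment from `x` to `y`.
  refine abs_sub_le_of_directional_bound hSc hx hy fun s hs ε hε => ?_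
  obtain ⟨r, hr, hloc⟩ := hlocal s hs
  have hc : Tendsto (fun t : ℝ => s + t • (y - x)) (𝓝 0) (𝓝 s) := by
    have : Continuous fun t : ℝ => s + t • (y - x) := by fun_prop
    simpa using this.tendsto 0
  filter_upwards [hc.eventually (Metric.ball_mem_nhds s hr)] with t ht
  refine (hloc _ ht).trans ?_
  rw [add_sub_cancel_left, norm_smul, Real.norm_eq_abs]
  nlinarith [abs_nonneg t, mul_nonneg hε.le (abs_nonneg t)]

end Analysis

/-! ### The Lipschitz constant of the advantage -/

lemma zeroExt_of_mem {E : Type*} {D : Set E} (f : D → ℝ) {x : E} (h : x ∈ D) :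
    zeroExt D f x = f ⟨x, h⟩ := dif_pos h

lemma zeroExt_coe {E : Type*} {D : Set E} (f : D → ℝ) (x : D) : zeroExt D f x = f x :=
  zeroExt_of_mem f x.2

/-- The mean value inequality on a convex set accepts any derivative within the set, so `D` may have
empty interior. -/
lemma DiffOn.abs_sub_le {d : ℕ} {D : Set (EuclideanSpace ℝ (Fin d))} (hD : Convex ℝ D)
    {f : D → ℝ} (hf : DiffOn D f) (hL : Lip D f ≠ ⊤) (x y : D) :
    |f x - f y| ≤ (Lip D f).toReal * dist x y := by
  have h := hD.norm_image_sub_le_of_norm_fderivWithin_le (C := (Lip D f).toReal) hf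
    (fun z hz => ?_) y.2 x.2
  · rwa [zeroExt_coe, zeroExt_coe, Real.norm_eq_abs, ← dist_eq_norm, ← Subtype.dist_eq] at h
  · rw [← toReal_enorm]
    exact ENNReal.toReal_mono hL
      (le_iSup (fun x : D => ‖fderivWithin ℝ (zeroExt D f) D x‖ₑ) ⟨z, hz⟩)

section Advantage

variable {n m : ℕ} {S : Set (EuclideanSpace ℝ (Fin n))} {A : Set (EuclideanSpace ℝ (Fin m))}

lemma hasDerivAt_zeroExt_line (hS : IsOpen S) {f : S → ℝ} (hf : DiffOn S f)
    (x : EuclideanSpace ℝ (Fin n)) (j : Fin n) (t : ℝ)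
    (hx : x + t • EuclideanSpace.single j 1 ∈ S) :
    HasDerivAt (fun u : ℝ => zeroExt S f (x + u • EuclideanSpace.single j 1))
      (pderiv S f ⟨_, hx⟩ j) t := by
  have hline : HasDerivAt (fun u : ℝ => x + u • EuclideanSpace.single j (1 : ℝ))
      (EuclideanSpace.single j (1 : ℝ)) t := by
    simpa using ((hasDerivAt_id t).smul_const (EuclideanSpace.single j (1 : ℝ))).const_add x
  exact ((hf _ hx).differentiableAt (hS.mem_nhds hx)).hasFDerivAt.comp_hasDerivAt t hline

/-- The increments of `q` in the state are Lipschitz in the action. -/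
lemma abs_increment_sub_le (hS : IsOpen S) (hSc : Convex ℝ S) (hA : Convex ℝ A) {q : S → A → ℝ}
    (hqs : ∀ a, DiffOn S fun s => q s a)
    (hqsa : ∀ s j, DiffOn A fun a => pderiv S (fun s' => q s' a) s j) {K : ℝ}
    (hK : ∀ s j, Lip A (fun a => pderiv S (fun s' => q s' a) s j) ≤ ENNReal.ofReal K)
    (hK0 : 0 ≤ K) (s s' : S) (j : Fin n) (h : ℝ)
    (hs' : s'.1 = s.1 + h • EuclideanSpace.single j (1 : ℝ)) (a b : A) :
    |(q s' a - q s a) - (q s' b - q s b)| ≤ K * dist a b * |h| := by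
  set x : EuclideanSpace ℝ (Fin n) := s.1 with hx
  have hmem : ∀ t ∈ Set.Icc (0 : ℝ) 1, x + (t * h) • EuclideanSpace.single j 1 ∈ S := by
    intro t ht
    have := hSc.add_smul_sub_mem s.2 s'.2 ht
    rwa [hs', add_sub_cancel_left, smul_smul] at this
  have hder : ∀ (t : ℝ) (ht : t ∈ Set.Icc (0 : ℝ) 1) (a : A),
      HasDerivAt (fun t : ℝ => zeroExt S (fun s => q s a)
        (x + (t * h) • EuclideanSpace.single j 1))
        (pderiv S (fun s => q s a) ⟨_, hmem t ht⟩ j * h) t := by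
    intro t ht a
    have h1 := hasDerivAt_zeroExt_line hS (hqs a) x j (t * h) (hmem t ht)
    have h2 : HasDerivAt (fun t : ℝ => t * h) h t := by
      simpa using (hasDerivAt_id t).mul_const h
    exact HasDerivAt.comp t h1 h2
  classical
  -- The mean value inequality is applied along the segment from `s` to `s'` to the difference of
  -- the values at `a` and `b`; its derivative is `h` times a difference of partial derivatives of
  -- `q`, Lipschitz in the action.
  have hmv := norm_image_sub_le_of_norm_deriv_le_segment_01' (C := K * dist a b * |h|)
    (f := fun t : ℝ => zeroExt S (fun s => q s a) (x + (t * h) • EuclideanSpace.single j 1) -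
      zeroExt S (fun s => q s b) (x + (t * h) • EuclideanSpace.single j 1))
    (f' := fun t => if ht : t ∈ Set.Icc (0 : ℝ) 1 then
      pderiv S (fun s => q s a) ⟨_, hmem t ht⟩ j * h -
        pderiv S (fun s => q s b) ⟨_, hmem t ht⟩ j * h else 0) ?_ ?_
  · have e1 : x + ((1 : ℝ) * h) • EuclideanSpace.single j (1 : ℝ) = s' := by rw [hs', one_mul]
    have e0 : x + ((0 : ℝ) * h) • EuclideanSpace.single j (1 : ℝ) = s := by simp [hx]
    simp only [e1, e0, zeroExt_coe] at hmv
    rw [Real.norm_eq_abs, sub_sub_sub_comm] at hmv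
    exact hmv
  · intro t ht
    rw [dif_pos ht]
    exact ((hder t ht a).sub (hder t ht b)).hasDerivWithinAt
  · intro t ht
    have ht' : t ∈ Set.Icc (0 : ℝ) 1 := ⟨ht.1, ht.2.le⟩
    rw [dif_pos ht', ← sub_mul, norm_mul, Real.norm_eq_abs, Real.norm_eq_abs]
    refine mul_le_mul_of_nonneg_right ?_ (abs_nonneg h)
    have hne := ne_top_of_le_ne_top ENNReal.ofReal_ne_top (hK ⟨_, hmem t ht'⟩ j)
    refine ((hqsa ⟨_, hmem t ht'⟩ j).abs_sub_le hA hne a b).trans ?_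
    exact mul_le_mul_of_nonneg_right (ENNReal.toReal_le_of_le_ofReal hK0 (hK _ j)) dist_nonneg

/-- First-order bound of the change of `∫ q s dζ - ∫ q s dν` in the state. -/
lemma eventually_abs_integral_increment_le (hS : IsOpen S) (hSc : Convex ℝ S) (hA : Convex ℝ A)
    {q : S → A → ℝ} (hqs : ∀ a, DiffOn S fun s => q s a)
    (hqsa : ∀ s j, DiffOn A fun a => pderiv S (fun s' => q s' a) s j) {K : ℝ}
    (hK : ∀ s j, Lip A (fun a => pderiv S (fun s' => q s' a) s j) ≤ ENNReal.ofReal K)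
    (hK0 : 0 ≤ K) (hm : ∀ s, Measurable (q s)) {b : ℝ} (hb : ∀ s a, |q s a| ≤ b)
    {ζ ν : Measure A} [IsProbabilityMeasure ζ] (hW : W ζ ν ≠ ⊤) (s : S) (j : Fin n)
    {ε : ℝ} (hε : 0 < ε) :
    ∀ᶠ h in 𝓝[≠] (0 : ℝ), ∀ hs : (s : EuclideanSpace ℝ (Fin n)) +
        h • EuclideanSpace.single j 1 ∈ S,
      |∫ a, (q ⟨_, hs⟩ a - q s a) ∂ζ - ∫ a, (q ⟨_, hs⟩ a - q s a) ∂ν| ≤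
        ((Lip A (fun a => pderiv S (fun s' => q s' a) s j)).toReal * (W ζ ν).toReal + ε)
          * |h| := by
  set x : EuclideanSpace ℝ (Fin n) := s.1 with hx
  set Λ := (Lip A (fun a => pderiv S (fun s' => q s' a) s j)).toReal with hΛ
  have hΛ0 : 0 ≤ Λ := ENNReal.toReal_nonneg
  have hLne := ne_top_of_le_ne_top ENNReal.ofReal_ne_top (hK s j)
  have hδ : 0 < ε / (Λ + 1) := by positivity
  -- One nearly optimal coupling is fixed before `h` tends to `0`; its slack is chosen so that `Λ`
  -- times it is strictly below `ε`.
  obtain ⟨c, h1, h2, h3⟩ := exists_coupling_lt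
    (ENNReal.lt_add_right hW (ENNReal.ofReal_pos.2 hδ).ne')
  have := isProbabilityMeasure_coupling h1
  have hdist := integrable_dist_of_lintegral_edist h3.ne_top
  have hcost : (∫⁻ p, edist p.1 p.2 ∂c).toReal ≤ (W ζ ν).toReal + ε / (Λ + 1) := by
    have := ENNReal.toReal_mono (by simp [hW]) h3.le
    rwa [ENNReal.toReal_add hW ENNReal.ofReal_ne_top, ENNReal.toReal_ofReal hδ.le] at this
  set ψ : ℝ → A → ℝ := fun h a =>
    zeroExt S (fun s => q s a) (x + h • EuclideanSpace.single j 1) - q s a with hψ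
  have hψS : ∀ (h : ℝ) (hs : x + h • EuclideanSpace.single j 1 ∈ S),
      ψ h = fun a => q ⟨_, hs⟩ a - q s a := by
    intro h hs
    funext a
    simp only [hψ, zeroExt_of_mem _ hs]
  have hnear : ∀ᶠ h in 𝓝[≠] (0 : ℝ), x + h • EuclideanSpace.single j 1 ∈ S := by
    have hc : Continuous fun h : ℝ => x + h • EuclideanSpace.single j (1 : ℝ) := by fun_prop
    refine nhdsWithin_le_nhds (hc.continuousAt.eventually_mem (hS.mem_nhds ?_))
    simp [hx]
  -- The uniform constant `K` serves only as the dominating bound. Passing to the limit under the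
  -- integral leaves the constant `Λ` of the single partial derivative at `s`, which is needed for a
  -- Euclidean norm over `j`.
  have hlim : Tendsto (fun h : ℝ => ∫ p, h⁻¹ * (ψ h p.1 - ψ h p.2) ∂c) (𝓝[≠] 0)
      (𝓝 (∫ p, (pderiv S (fun s' => q s' p.1) s j - pderiv S (fun s' => q s' p.2) s j) ∂c)) := by
    refine tendsto_integral_filter_of_dominated_convergence (fun p => K * dist p.1 p.2) ?_ ?_
      (hdist.const_mul K) (Eventually.of_forall fun p => ?_)
    · filter_upwards [hnear] with h hs
      rw [hψS h hs]
      have hmm : Measurable fun a => q ⟨_, hs⟩ a - q s a := (hm _).sub (hm _)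
      exact (((hmm.comp measurable_fst).sub (hmm.comp measurable_snd)).const_mul
        _).aestronglyMeasurable
    · filter_upwards [hnear, self_mem_nhdsWithin] with h hs hne
      refine Eventually.of_forall fun p => ?_
      rw [hψS h hs, norm_mul, norm_inv, Real.norm_eq_abs, Real.norm_eq_abs]
      have hpos : 0 < |h| := abs_pos.2 hne
      rw [inv_mul_le_iff₀ hpos, mul_comm]
      exact abs_increment_sub_le hS hSc hA hqs hqsa hK hK0 s ⟨_, hs⟩ j h rfl p.1 p.2
    · have hone : ∀ a, Tendsto (fun h : ℝ => h⁻¹ * ψ h a) (𝓝[≠] 0)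
          (𝓝 (pderiv S (fun s' => q s' a) s j)) := by
        intro a
        have h0 : x + (0 : ℝ) • EuclideanSpace.single j 1 ∈ S := by simp [hx]
        have hd := hasDerivAt_zeroExt_line hS (hqs a) x j 0 h0
        rw [hasDerivAt_iff_tendsto_slope_zero] at hd
        have e0 : (⟨_, h0⟩ : S) = s := Subtype.ext (by simp [hx])
        rw [e0, zeroExt_of_mem _ h0, e0] at hd
        simpa only [zero_add, smul_eq_mul] using hd
      simpa only [mul_sub] using (hone p.1).sub (hone p.2)
  have hI : |∫ p, (pderiv S (fun s' => q s' p.1) s j - pderiv S (fun s' => q s' p.2) s j) ∂c| <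
      Λ * (W ζ ν).toReal + ε := by
    have h4 : |∫ p, (pderiv S (fun s' => q s' p.1) s j - pderiv S (fun s' => q s' p.2) s j) ∂c| ≤
        ∫ p, Λ * dist p.1 p.2 ∂c :=
      norm_integral_le_of_norm_le (f := fun p : A × A =>
        pderiv S (fun s' => q s' p.1) s j - pderiv S (fun s' => q s' p.2) s j)
        (hdist.const_mul Λ) (Eventually.of_forall fun p => (hqsa s j).abs_sub_le hA hLne p.1 p.2)
    rw [integral_const_mul, integral_dist_eq] at h4
    have h5 : Λ * (ε / (Λ + 1)) < ε := by
      rw [mul_div_assoc', div_lt_iff₀ (by positivity)]; nlinarith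
    have h6 := mul_le_mul_of_nonneg_left hcost hΛ0
    linarith
  filter_upwards [hnear, self_mem_nhdsWithin, hlim.abs.eventually_lt_const hI]
    with h _ hne hlt hs
  have hpos : 0 < |h| := abs_pos.2 hne
  have hmm : Measurable fun a => q ⟨_, hs⟩ a - q s a := (hm _).sub (hm _)
  rw [integral_sub_integral_eq_coupling h1 h2 hmm (b := b + b)
    (fun a => (abs_sub _ _).trans (add_le_add (hb _ _) (hb _ _)))]
  rw [hψS h hs, integral_const_mul, abs_mul, abs_inv, inv_mul_lt_iff₀ hpos, mul_comm] at hlt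
  exact hlt.le

variable (M : MDP S A) (π₁ π₂ : Kernel S A)

lemma eventually_mixW_le (s : S) (j : Fin n) (hmp : mixPartial π₁ π₂ s j ≠ ⊤) {ε : ℝ}
    (hε : 0 < ε) :
    ∀ᶠ h in 𝓝[≠] (0 : ℝ), ∀ hs : (s : EuclideanSpace ℝ (Fin n)) +
        h • EuclideanSpace.single j 1 ∈ S,
      mixW π₁ π₂ s ⟨_, hs⟩ ≤ ENNReal.ofReal (((mixPartial π₁ π₂ s j).toReal + ε) * |h|) := by
  have hlt : mixPartial π₁ π₂ s j < mixPartial π₁ π₂ s j + ENNReal.ofReal ε :=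
    ENNReal.lt_add_right hmp (ENNReal.ofReal_pos.2 hε).ne'
  have hev := eventually_lt_of_limsup_lt (show limsup _ _ < _ from hlt)
  filter_upwards [hev, self_mem_nhdsWithin] with h hh hne hs
  rw [dif_pos hs] at hh
  have h0 : ‖h‖ₑ ≠ 0 := by simpa using hne
  have h1 := (ENNReal.div_le_iff h0 (by simp)).1 hh.le
  rwa [← ENNReal.ofReal_toReal hmp, ← ENNReal.ofReal_add ENNReal.toReal_nonneg hε.le,
    Real.enorm_eq_ofReal_abs, ← ENNReal.ofReal_mul (by positivity)] at h1

variable [IsMarkovKernel π₁] [IsMarkovKernel π₂]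

/-- Regrouping the four integrals pairs `π₂ s' + π₁ s` against `π₂ s + π₁ s'`. Halving both sums
gives probability measures, whence `mixW` and the factor `2`. -/
lemma abs_mixed_integral_le {q : A → ℝ} (hm : Measurable q) {b : ℝ} (hb : ∀ a, |q a| ≤ b)
    {l : ℝ} (hl : 0 ≤ l) (hq : ∀ x y, |q x - q y| ≤ l * dist x y) (s s' : S)
    (hmix : mixW π₁ π₂ s s' ≠ ⊤) :
    |(∫ a, q a ∂(π₂ s') - ∫ a, q a ∂(π₁ s')) - (∫ a, q a ∂(π₂ s) - ∫ a, q a ∂(π₁ s))| ≤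
      2 * l * (mixW π₁ π₂ s s').toReal := by
  have hprob : ∀ ζ ν : Measure A, IsProbabilityMeasure ζ → IsProbabilityMeasure ν →
      IsProbabilityMeasure ((2⁻¹ : ℝ≥0∞) • (ζ + ν)) := by
    intro ζ ν _ _
    constructor
    rw [Measure.smul_apply, Measure.add_apply, measure_univ, measure_univ, one_add_one_eq_two,
      smul_eq_mul, ENNReal.inv_mul_cancel two_ne_zero ENNReal.ofNat_ne_top]
  have := hprob (π₂ s') (π₁ s) inferInstance inferInstance
  have hint : ∀ (ζ : Measure A) [IsProbabilityMeasure ζ], Integrable q ζ :=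
    fun ζ _ => integrable_of_bound hm hb
  have h := abs_integral_sub_le_mul_W hm hb hl hq hmix
  rw [integral_smul_measure, integral_smul_measure, integral_add_measure (hint _) (hint _),
    integral_add_measure (hint _) (hint _), ← smul_sub, smul_eq_mul, abs_mul] at h
  have e : |(2⁻¹ : ℝ≥0∞).toReal| = 2⁻¹ := by simp
  rw [e] at h
  have e2 : (∫ a, q a ∂(π₂ s') - ∫ a, q a ∂(π₁ s')) - (∫ a, q a ∂(π₂ s) - ∫ a, q a ∂(π₁ s)) =
      (∫ a, q a ∂(π₂ s') + ∫ a, q a ∂(π₁ s)) - (∫ a, q a ∂(π₂ s) + ∫ a, q a ∂(π₁ s')) := by ring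
  rw [e2]
  unfold mixW
  linarith

/-- First-order bound of the advantage in the direction of a coordinate of the state. -/
lemma eventually_abs_adv_sub_le (hS : IsOpen S) (hSc : Convex ℝ S) (hA : Convex ℝ A)
    (hQa : ∀ s, DiffOn A (M.Q π₁ s)) (hQs : ∀ a, DiffOn S (fun s => M.Q π₁ s a))
    (hQsa : ∀ s j, DiffOn A (fun a => pderiv S (fun s' => M.Q π₁ s' a) s j)) {l K : ℝ}
    (hl0 : 0 ≤ l) (hl : ∀ s, Lip A (M.Q π₁ s) ≤ ENNReal.ofReal l) (hK0 : 0 ≤ K)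
    (hK : ∀ s j, Lip A (fun a => pderiv S (fun s' => M.Q π₁ s' a) s j) ≤ ENNReal.ofReal K)
    (s : S) (j : Fin n) (hmp : mixPartial π₁ π₂ s j ≠ ⊤) {w : ℝ} (hw0 : 0 ≤ w)
    (hw : W (π₂ s) (π₁ s) ≤ ENNReal.ofReal w) {ε : ℝ} (hε : 0 < ε) :
    ∀ᶠ h in 𝓝 (0 : ℝ),
      |zeroExt S (fun s => M.adv π₁ s π₂)
          ((s : EuclideanSpace ℝ (Fin n)) + h • EuclideanSpace.single j 1) -
        zeroExt S (fun s => M.adv π₁ s π₂) s| ≤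
        (2 * l * (mixPartial π₁ π₂ s j).toReal +
          (Lip A (fun a => pderiv S (fun s' => M.Q π₁ s' a) s j)).toReal * w + ε) * |h| := by
  set x : EuclideanSpace ℝ (Fin n) := s.1 with hx
  set Λ := (Lip A (fun a => pderiv S (fun s' => M.Q π₁ s' a) s j)).toReal with hΛ
  have hΛ0 : 0 ≤ Λ := ENNReal.toReal_nonneg
  have hlip : ∀ s a b, |M.Q π₁ s a - M.Q π₁ s b| ≤ l * dist a b := fun s a b =>
    ((hQa s).abs_sub_le hA (ne_top_of_le_ne_top ENNReal.ofReal_ne_top (hl s)) a b).trans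
      (mul_le_mul_of_nonneg_right (ENNReal.toReal_le_of_le_ofReal hl0 (hl s)) dist_nonneg)
  have hnear : ∀ᶠ h in 𝓝[≠] (0 : ℝ), x + h • EuclideanSpace.single j 1 ∈ S := by
    have hc : Continuous fun h : ℝ => x + h • EuclideanSpace.single j (1 : ℝ) := by fun_prop
    refine nhdsWithin_le_nhds (hc.continuousAt.eventually_mem (hS.mem_nhds ?_))
    simp [hx]
  have hδ : 0 < ε / 2 / (2 * l + 1) := by positivity
  have hWne := ne_top_of_le_ne_top ENNReal.ofReal_ne_top hw
  have hmain : ∀ᶠ h in 𝓝[≠] (0 : ℝ),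
      |zeroExt S (fun s => M.adv π₁ s π₂) (x + h • EuclideanSpace.single j 1) -
        zeroExt S (fun s => M.adv π₁ s π₂) s| ≤
        (2 * l * (mixPartial π₁ π₂ s j).toReal + Λ * w + ε) * |h| := by
    filter_upwards [hnear, eventually_mixW_le π₁ π₂ s j hmp hδ,
      eventually_abs_integral_increment_le hS hSc hA hQs hQsa hK hK0 (M.measurable_Q_right π₁)
        (M.abs_Q_le π₁) hWne s j (half_pos hε)] with h hs hmix hinc
    specialize hmix hs
    specialize hinc hs
    set s' : S := ⟨_, hs⟩ with hs'
    have hint : ∀ (s : S) (ζ : Measure A) [IsProbabilityMeasure ζ], Integrable (M.Q π₁ s) ζ :=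
      fun s ζ _ => integrable_of_bound (M.measurable_Q_right π₁ s) (M.abs_Q_le π₁ s)
    rw [integral_sub (hint _ _) (hint _ _), integral_sub (hint _ _) (hint _ _)] at hinc
    have hfirst := abs_mixed_integral_le π₁ π₂ (M.measurable_Q_right π₁ s') (M.abs_Q_le π₁ s')
      hl0 (hlip s') s s' (ne_top_of_le_ne_top ENNReal.ofReal_ne_top hmix)
    have hmix' : (mixW π₁ π₂ s s').toReal ≤
        ((mixPartial π₁ π₂ s j).toReal + ε / 2 / (2 * l + 1)) * |h| :=
      ENNReal.toReal_le_of_le_ofReal (by positivity) hmix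
    rw [zeroExt_of_mem _ hs, zeroExt_coe, M.adv_eq, M.adv_eq]
    have hb1 : 2 * l * (mixW π₁ π₂ s s').toReal ≤
        (2 * l * (mixPartial π₁ π₂ s j).toReal + ε / 2) * |h| := by
      refine (mul_le_mul_of_nonneg_left hmix' (by positivity)).trans ?_
      rw [← mul_assoc]
      refine mul_le_mul_of_nonneg_right ?_ (abs_nonneg h)
      rw [mul_add]
      have : 2 * l * (ε / 2 / (2 * l + 1)) ≤ ε / 2 := by
        rw [mul_div_assoc', div_le_iff₀ (by positivity)]; nlinarith
      linarith
    have hb2 : (Λ * (W (π₂ s) (π₁ s)).toReal + ε / 2) * |h| ≤ (Λ * w + ε / 2) * |h| := by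
      refine mul_le_mul_of_nonneg_right ?_ (abs_nonneg h)
      have := mul_le_mul_of_nonneg_left (ENNReal.toReal_le_of_le_ofReal hw0 hw) hΛ0
      linarith
    -- Discrete product rule: the policies move from `s` to `s'` with the integrand `Q` at `s'`,
    -- then `Q` moves with the policies frozen at `s`.
    have htri := abs_add_le
      ((∫ a, M.Q π₁ s' a ∂(π₂ s') - ∫ a, M.Q π₁ s' a ∂(π₁ s')) -
        (∫ a, M.Q π₁ s' a ∂(π₂ s) - ∫ a, M.Q π₁ s' a ∂(π₁ s)))
      ((∫ a, M.Q π₁ s' a ∂(π₂ s) - ∫ a, M.Q π₁ s a ∂(π₂ s)) -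
        (∫ a, M.Q π₁ s' a ∂(π₁ s) - ∫ a, M.Q π₁ s a ∂(π₁ s)))
    have e : (∫ a, M.Q π₁ s' a ∂(π₂ s') - ∫ a, M.Q π₁ s' a ∂(π₁ s')) -
        (∫ a, M.Q π₁ s' a ∂(π₂ s) - ∫ a, M.Q π₁ s' a ∂(π₁ s)) +
      ((∫ a, M.Q π₁ s' a ∂(π₂ s) - ∫ a, M.Q π₁ s a ∂(π₂ s)) -
        (∫ a, M.Q π₁ s' a ∂(π₁ s) - ∫ a, M.Q π₁ s a ∂(π₁ s))) =
      (∫ a, M.Q π₁ s' a ∂(π₂ s') - ∫ a, M.Q π₁ s' a ∂(π₁ s')) -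
        (∫ a, M.Q π₁ s a ∂(π₂ s) - ∫ a, M.Q π₁ s a ∂(π₁ s)) := by ring
    rw [e] at htri
    linarith
  rw [eventually_nhdsWithin_iff] at hmain
  filter_upwards [hmain] with h hh
  by_cases h0 : h = 0
  · simp [h0, hx]
  · exact hh h0

/-- Minkowski's inequality in squared form, with Cauchy–Schwarz for the cross term; it combines the
two parts of the product rule over all coordinates. -/
lemma sum_sq_le_of_sum_sq_le {u v : Fin n → ℝ} {g k a w : ℝ} (hg : 0 ≤ g)
    (hk : 0 ≤ k) (ha : 0 ≤ a) (hw : 0 ≤ w) (h1 : ∑ j, u j ^ 2 ≤ g ^ 2)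
    (h2 : ∑ j, v j ^ 2 ≤ k ^ 2) : ∑ j, (a * u j + v j * w) ^ 2 ≤ (a * g + k * w) ^ 2 := by
  have h3 := Finset.sum_mul_sq_le_sq_mul_sq Finset.univ u v
  have h4 : ∑ j, u j * v j ≤ g * k := by
    refine (abs_le_of_sq_le_sq' (h3.trans ?_) (by positivity)).2
    rw [mul_pow]
    exact mul_le_mul h1 h2 (Finset.sum_nonneg fun _ _ => sq_nonneg _) (sq_nonneg _)
  have e : ∑ j, (a * u j + v j * w) ^ 2 =
      a ^ 2 * ∑ j, u j ^ 2 + 2 * a * w * ∑ j, u j * v j + w ^ 2 * ∑ j, v j ^ 2 := by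
    simp only [Finset.mul_sum, ← Finset.sum_add_distrib]
    exact Finset.sum_congr rfl fun j _ => by ring
  rw [e]
  have h5 := mul_le_mul_of_nonneg_left h1 (sq_nonneg a)
  have h6 := mul_le_mul_of_nonneg_left h2 (sq_nonneg w)
  have h7 := mul_le_mul_of_nonneg_left h4 (by positivity : 0 ≤ 2 * a * w)
  nlinarith

lemma sum_toReal_sq_le {u : Fin n → ℝ≥0∞} {g : ℝ}
    (h : ∑ j, u j ^ 2 ≤ ENNReal.ofReal g) (hg : 0 ≤ g) :
    (∀ j, u j ≠ ⊤) ∧ ∑ j, (u j).toReal ^ 2 ≤ g := by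
  have hne : ∀ j, u j ^ 2 ≠ ⊤ := fun j => ne_top_of_le_ne_top ENNReal.ofReal_ne_top
    ((Finset.single_le_sum (f := fun j => u j ^ 2) (fun _ _ => bot_le) (Finset.mem_univ j)).trans h)
  refine ⟨fun j hj => hne j (by simp [hj]), ?_⟩
  have := ENNReal.toReal_le_of_le_ofReal hg h
  rwa [ENNReal.toReal_sum fun j _ => hne j, Finset.sum_congr rfl fun j _ =>
    ENNReal.toReal_pow (u j) 2] at this

/-- The advantage is Lipschitz in the state. -/
lemma abs_adv_sub_le (hS : IsOpen S) (hSc : Convex ℝ S) (hA : Convex ℝ A)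
    (hQa : ∀ s, DiffOn A (M.Q π₁ s)) (hQs : ∀ a, DiffOn S (fun s => M.Q π₁ s a))
    (hQsa : ∀ s j, DiffOn A (fun a => pderiv S (fun s' => M.Q π₁ s' a) s j)) {l k g w : ℝ}
    (hl0 : 0 ≤ l) (hl : ∀ s, Lip A (M.Q π₁ s) ≤ ENNReal.ofReal l)
    (hk0 : 0 ≤ k) (hk : ∀ s, lipGrad (M.Q π₁) s ≤ ENNReal.ofReal k)
    (hg0 : 0 ≤ g) (hg : ∀ s, LG2 π₁ π₂ s ≤ ENNReal.ofReal (g ^ 2))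
    (hw0 : 0 ≤ w) (hw : ∀ s, W (π₂ s) (π₁ s) ≤ ENNReal.ofReal w) (s s' : S) :
    |M.adv π₁ s π₂ - M.adv π₁ s' π₂| ≤ (2 * l * g + k * w) * dist s s' := by
  have hk2 : ∀ s, ∑ j, Lip A (fun a => pderiv S (fun s' => M.Q π₁ s' a) s j) ^ 2 ≤
      ENNReal.ofReal (k ^ 2) := by
    intro s
    have := ENNReal.rpow_le_rpow (hk s) (zero_le_two : (0 : ℝ) ≤ 2)
    rw [lipGrad, ← ENNReal.rpow_mul, one_div, inv_mul_cancel₀ two_ne_zero, ENNReal.rpow_one,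
      ENNReal.rpow_two, ← ENNReal.ofReal_pow hk0] at this
    exact this
  have hK : ∀ s j, Lip A (fun a => pderiv S (fun s' => M.Q π₁ s' a) s j) ≤ ENNReal.ofReal k := by
    intro s j
    have := (Finset.single_le_sum
      (f := fun j => Lip A (fun a => pderiv S (fun s' => M.Q π₁ s' a) s j) ^ 2)
      (fun _ _ => bot_le) (Finset.mem_univ j)).trans (hk2 s)
    rw [ENNReal.ofReal_pow hk0] at this
    exact (ENNReal.pow_le_pow_left_iff two_ne_zero).1 this
  classical
  have hmain := abs_sub_le_of_partial_bound hS hSc (f := zeroExt S fun s => M.adv π₁ s π₂)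
    (F := 2 * l * g + k * w)
    (D := fun x j => if hx : x ∈ S then 2 * l * (mixPartial π₁ π₂ ⟨x, hx⟩ j).toReal +
      (Lip A (fun a => pderiv S (fun s' => M.Q π₁ s' a) ⟨x, hx⟩ j)).toReal * w else 0)
    (by positivity) ?_ ?_ ?_ s'.2 s.2
  · rwa [zeroExt_coe, zeroExt_coe, ← dist_eq_norm, ← Subtype.dist_eq] at hmain
  · intro x hx j
    rw [dif_pos hx]
    positivity
  · intro x hx
    simp only [dif_pos hx]
    exact sum_sq_le_of_sum_sq_le hg0 hk0 (by positivity) hw0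
      (sum_toReal_sq_le (hg ⟨x, hx⟩) (sq_nonneg g)).2
      (sum_toReal_sq_le (hk2 ⟨x, hx⟩) (sq_nonneg k)).2
  · intro x hx j ε hε
    simp only [dif_pos hx]
    exact eventually_abs_adv_sub_le M π₁ π₂ hS hSc hA hQa hQs hQsa hl0 hl hk0 hK ⟨x, hx⟩ j
      ((sum_toReal_sq_le (hg ⟨x, hx⟩) (sq_nonneg g)).1 j) hw0 (hw _) hε

end Advantage

/-! ### The distance of the state distributions under the two policies -/

/-- The partial sums satisfy `S (N + 1) ≤ γ b / (1 - γ) + γ L * S N`, and the claimed bound is the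
fixed point of this affine map. The leading `γ` comes from `d 0 = 0`. -/
lemma sum_pow_mul_le_of_recursion {d : ℕ → ℝ} {b L γ : ℝ} (hd : d 0 = 0)
    (hrec : ∀ t, d (t + 1) ≤ b + L * d t) (hb : 0 ≤ b) (hL : 0 ≤ L) (hγ : 0 ≤ γ) (hγ1 : γ < 1)
    (hγL : γ * L < 1) (N : ℕ) :
    ∑ t ∈ Finset.range N, γ ^ t * d t ≤ γ * b / ((1 - γ) * (1 - γ * L)) := by
  have h1 : 0 < 1 - γ := by linarith
  have h2 : 0 < 1 - γ * L := by linarith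
  induction N with
  | zero => simp only [Finset.range_zero, Finset.sum_empty]; positivity
  | succ N ih =>
    have hgeom : ∑ t ∈ Finset.range N, γ ^ t ≤ (1 - γ)⁻¹ := by
      rw [← tsum_geometric_of_lt_one hγ hγ1]
      exact (summable_geometric_of_lt_one hγ hγ1).sum_le_tsum _ fun _ _ => by positivity
    rw [Finset.sum_range_succ', hd, mul_zero, add_zero]
    calc ∑ t ∈ Finset.range N, γ ^ (t + 1) * d (t + 1)
        ≤ ∑ t ∈ Finset.range N, (γ * b * γ ^ t + γ * L * (γ ^ t * d t)) := by
          refine Finset.sum_le_sum fun t _ => ?_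
          refine (mul_le_mul_of_nonneg_left (hrec t) (by positivity)).trans (le_of_eq ?_)
          ring
      _ = γ * b * ∑ t ∈ Finset.range N, γ ^ t +
            γ * L * ∑ t ∈ Finset.range N, γ ^ t * d t := by
          rw [Finset.sum_add_distrib, Finset.mul_sum, Finset.mul_sum]
      _ ≤ γ * b * (1 - γ)⁻¹ + γ * L * (γ * b / ((1 - γ) * (1 - γ * L))) := by gcongr
      _ = γ * b / ((1 - γ) * (1 - γ * L)) := by field_simp; ring

lemma sum_pow_mul_le_of_le {d : ℕ → ℝ} {c γ : ℝ} (hd : d 0 = 0) (hc : ∀ t, d t ≤ c)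
    (hc0 : 0 ≤ c) (hγ : 0 ≤ γ) (hγ1 : γ < 1) (N : ℕ) :
    ∑ t ∈ Finset.range N, γ ^ t * d t ≤ γ * c / (1 - γ) := by
  have := sum_pow_mul_le_of_recursion (L := 0) hd (fun t => by simpa using hc (t + 1)) hc0 le_rfl
    hγ hγ1 (by simp) N
  simpa using this

lemma sum_Icc_one_eq_sum_range (p q : ℕ → ℝ≥0∞) (t : ℕ) :
    ∑ k ∈ Finset.Icc 1 t, p (t - k) * ∏ i ∈ Finset.Icc 1 (k - 1), q (t - i) =
      ∑ k ∈ Finset.range t, p (t - (k + 1)) * ∏ i ∈ Finset.range k, q (t - (i + 1)) := by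
  have hI : ∀ t, Finset.Icc 1 t = Finset.Ico 1 (t + 1) := fun t => by ext; simp
  simp only [hI, Finset.sum_Ico_eq_sum_range, Finset.prod_Ico_eq_prod_range, Nat.add_sub_cancel,
    add_comm 1]

lemma sum_Icc_one_succ (p q : ℕ → ℝ≥0∞) (t : ℕ) :
    ∑ k ∈ Finset.Icc 1 (t + 1), p (t + 1 - k) * ∏ i ∈ Finset.Icc 1 (k - 1), q (t + 1 - i) =
      p t + q t * ∑ k ∈ Finset.Icc 1 t, p (t - k) * ∏ i ∈ Finset.Icc 1 (k - 1), q (t - i) := by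
  rw [sum_Icc_one_eq_sum_range, sum_Icc_one_eq_sum_range, Finset.sum_range_succ', Finset.mul_sum,
    add_comm]
  simp only [Finset.prod_range_succ', Nat.add_sub_add_right, Finset.range_zero, Finset.prod_empty,
    mul_one, Nat.sub_zero, zero_add, Nat.add_sub_cancel]
  congr 1
  exact Finset.sum_congr rfl fun k _ => by ring

/-- For `0 < w < ∞` every admissible `L` is at least `x / w`. At `w = 0` or `w = ∞` the claim can
fail, so these cases are treated apart where it is used. -/
lemma le_sInf_mul {x w : ℝ≥0∞} (h0 : w ≠ 0) (ht : w ≠ ⊤) : x ≤ sInf {L | x = L * w} * w := by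
  rw [← ENNReal.div_le_iff h0 ht]
  exact le_sInf fun L hL => (ENNReal.div_le_iff h0 ht).2 (le_of_eq hL)

namespace MDP

variable {X Y : Type*} [PseudoMetricSpace X] [MeasurableSpace X] [BorelSpace X]
  [SecondCountableTopology X] [MeasurableSpace Y] (M : MDP X Y) (π₁ π₂ : Kernel X Y)

lemma W_stepN_zero : W (M.stepN π₁ M.μ 0) (M.stepN π₂ M.μ 0) = 0 := W_self _

variable [IsMarkovKernel π₁] [IsMarkovKernel π₂]

/-- A lower bound of the payoff when the advantage is `F`-Lipschitz. -/
lemma le_payoff_of_abs_adv_sub_le {F B : ℝ} (hF : 0 ≤ F)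
    (hadv : ∀ s s', |M.adv π₁ s π₂ - M.adv π₁ s' π₂| ≤ F * dist s s')
    (hfin : ∀ t, W (M.stepN π₁ M.μ t) (M.stepN π₂ M.μ t) ≠ ⊤)
    (hB : ∀ N, ∑ t ∈ Finset.range N,
      M.γ ^ t * (W (M.stepN π₁ M.μ t) (M.stepN π₂ M.μ t)).toReal ≤ B) :
    M.payoff π₁ + 1 / (1 - M.γ) * ∫ s, M.adv π₁ s π₂ ∂(M.visitation π₁ M.μ) - F * B ≤
      M.payoff π₂ := by
  have hlim := (M.hasSum_payoff_sub_approx π₁ π₂).tendsto_sum_nat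
  have := ge_of_tendsto' hlim (b := -(F * B)) fun N => ?_
  · linarith
  calc -(F * B) ≤ -(F * ∑ t ∈ Finset.range N,
        M.γ ^ t * (W (M.stepN π₁ M.μ t) (M.stepN π₂ M.μ t)).toReal) :=
        neg_le_neg (mul_le_mul_of_nonneg_left (hB N) hF)
    _ ≤ _ := by
      rw [Finset.mul_sum, ← Finset.sum_neg_distrib]
      refine Finset.sum_le_sum fun t _ => ?_
      have h1 := abs_integral_sub_le_mul_W (M.measurable_adv π₁ π₂) (M.abs_adv_le π₁ π₂) hF hadv
        (hfin t)
      have h2 := mul_le_mul_of_nonneg_left (neg_le_neg (abs_le.1 h1).2)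
        (pow_nonneg M.γ_nonneg t)
      refine le_trans (le_of_eq ?_) (h2.trans (le_of_eq ?_)) <;> ring

/-- Since `0 * ∞ = 0`, a zero constant forces equal one-step laws even when the policy distance is
infinite. -/
lemma stepN_eq_of_policyLipschitz_zero [PseudoEMetricSpace Y]
    (hLπ : M.PolicyLipschitz π₁ π₂ 0) (t : ℕ) :
    M.stepN π₁ M.μ t = M.stepN π₂ M.μ t := by
  induction t with
  | zero => rfl
  | succ t ih =>
    rw [stepN, stepN, ← ih]
    refine eq_of_W_eq_zero (le_antisymm ?_ bot_le)
    simpa using hLπ (M.stepN π₁ M.μ t) inferInstance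

/-- The first-order approximation of the payoff is exact when the state distributions cannot
differ in the discounted future. -/
lemma payoff_eq_of_mul_eq_zero [PseudoEMetricSpace Y] {Lπ : ℝ≥0}
    (hLπ : M.PolicyLipschitz π₁ π₂ Lπ) (h : M.γ * Lπ = 0) :
    M.payoff π₂ = M.payoff π₁ + 1 / (1 - M.γ) *
      ∫ s, M.adv π₁ s π₂ ∂(M.visitation π₁ M.μ) := by
  refine sub_eq_zero.1 ((M.hasSum_payoff_sub_approx π₁ π₂).unique ?_)
  refine hasSum_of_forall_eq hasSum_zero fun t => ?_
  -- If `γ = 0`, only `t = 0` contributes, where both laws are `μ`; if `L_π = 0`, the laws agree at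
  -- all times.
  rcases mul_eq_zero.1 h with hγ | hL
  · cases t with
    | zero => simp [stepN]
    | succ t => simp [hγ]
  · obtain rfl : Lπ = 0 := by exact_mod_cast hL
    rw [M.stepN_eq_of_policyLipschitz_zero π₁ π₂ hLπ t, sub_self, mul_zero]

variable [StandardBorelSpace X]

/-- The first term isolates the change of policy at a common law, the second the change of law under
a common policy. -/
lemma W_stepN_succ_le (t : ℕ) : W (M.stepN π₁ M.μ (t + 1)) (M.stepN π₂ M.μ (t + 1)) ≤
    W (M.step π₁ (M.stepN π₁ M.μ t)) (M.step π₂ (M.stepN π₁ M.μ t)) +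
      W (M.step π₂ (M.stepN π₁ M.μ t)) (M.step π₂ (M.stepN π₂ M.μ t)) :=
  W_triangle _ _ _

variable [PseudoEMetricSpace Y]

/-- The sum defining `C_L` solves `S (t + 1) = L̂ t + L̃ t * S t`, the recursion that the triangle
inequality imposes on the distances. At zero denominators the rates carry no information: policy
Lipschitz continuity and the equality of laws at distance zero replace them. -/
lemma W_stepN_le_stabilityConst {Lπ : ℝ≥0} (hLπ : M.PolicyLipschitz π₁ π₂ Lπ)
    (hw : policyW π₁ π₂ ≠ ⊤) (hC : M.stabilityConst π₁ π₂ ≠ ⊤) (t : ℕ) :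
    W (M.stepN π₁ M.μ t) (M.stepN π₂ M.μ t) ≤ M.stabilityConst π₁ π₂ * policyW π₁ π₂ := by
  have hle : ∀ t : ℕ, (∑ k ∈ Finset.Icc 1 t, M.ratePolicy π₁ π₂ (t - k) *
      ∏ i ∈ Finset.Icc 1 (k - 1), M.rateState π₁ π₂ (t - i)) * policyW π₁ π₂ ≤
        M.stabilityConst π₁ π₂ * policyW π₁ π₂ := fun t =>
    mul_le_mul_left (le_iSup (fun t : ℕ => ∑ k ∈ Finset.Icc 1 t, M.ratePolicy π₁ π₂ (t - k) *
      ∏ i ∈ Finset.Icc 1 (k - 1), M.rateState π₁ π₂ (t - i)) t) _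
  refine le_trans ?_ (hle t)
  induction t with
  | zero => rw [W_stepN_zero]; exact bot_le
  | succ t ih =>
    rw [sum_Icc_one_succ (M.ratePolicy π₁ π₂) (M.rateState π₁ π₂), add_mul, mul_assoc]
    refine (M.W_stepN_succ_le π₁ π₂ t).trans (add_le_add ?_ ?_)
    · by_cases h0 : policyW π₁ π₂ = 0
      · have := hLπ (M.stepN π₁ M.μ t) inferInstance
        rw [h0, mul_zero] at this
        exact this.trans bot_le
      · exact le_sInf_mul h0 hw
    · refine le_trans ?_ (mul_le_mul_right ih _)
      by_cases h0 : W (M.stepN π₁ M.μ t) (M.stepN π₂ M.μ t) = 0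
      · rw [eq_of_W_eq_zero h0, W_self]
        exact bot_le
      · exact le_sInf_mul h0 (ne_top_of_le_ne_top (ENNReal.mul_ne_top hC hw) (ih.trans (hle t)))

/-- The discounted sum of the distances of the state distributions. -/
lemma sum_pow_mul_W_le {Lπ : ℝ≥0} (hLπ : M.PolicyLipschitz π₁ π₂ Lπ) {L : ℝ}
    (hL : (∃ Lμ : ℝ≥0, L = Lμ ∧ M.γ * Lμ < 1 ∧
        M.StateLipschitz π₁ Lμ ∧ M.StateLipschitz π₂ Lμ) ∨ (|M.γ * L| < 1 ∧
          M.stabilityConst π₁ π₂ ≤ ENNReal.ofReal (Lπ * ∑' t : ℕ, (M.γ * L) ^ t)))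
    {w : ℝ} (hw0 : 0 ≤ w) (hw : policyW π₁ π₂ ≤ ENNReal.ofReal w) :
    (∀ t, W (M.stepN π₁ M.μ t) (M.stepN π₂ M.μ t) ≠ ⊤) ∧
      ∀ N, ∑ t ∈ Finset.range N, M.γ ^ t * (W (M.stepN π₁ M.μ t) (M.stepN π₂ M.μ t)).toReal ≤
        M.γ * Lπ / ((1 - M.γ) * (1 - M.γ * L)) * w := by
  have hwne : policyW π₁ π₂ ≠ ⊤ := ne_top_of_le_ne_top ENNReal.ofReal_ne_top hw
  have h0 : (W (M.stepN π₁ M.μ 0) (M.stepN π₂ M.μ 0)).toReal = 0 := by simp [W_stepN_zero]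
  rcases hL with ⟨Lμ, rfl, hγL, -, hstate⟩ | ⟨hγL, hstab⟩
  · have hrec : ∀ t, W (M.stepN π₁ M.μ (t + 1)) (M.stepN π₂ M.μ (t + 1)) ≤
        Lπ * ENNReal.ofReal w + Lμ * W (M.stepN π₁ M.μ t) (M.stepN π₂ M.μ t) := fun t =>
      (M.W_stepN_succ_le π₁ π₂ t).trans (add_le_add
        ((hLπ _ inferInstance).trans (mul_le_mul_right hw _))
        (hstate _ _ inferInstance inferInstance))
    have hfin : ∀ t, W (M.stepN π₁ M.μ t) (M.stepN π₂ M.μ t) ≠ ⊤ := by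
      intro t
      induction t with
      | zero => simp [W_stepN_zero]
      | succ t ih =>
        refine ne_top_of_le_ne_top (ENNReal.add_ne_top.2
          ⟨ENNReal.mul_ne_top ENNReal.coe_ne_top ENNReal.ofReal_ne_top,
            ENNReal.mul_ne_top ENNReal.coe_ne_top ih⟩) (hrec t)
    refine ⟨hfin, fun N => ?_⟩
    have := sum_pow_mul_le_of_recursion
      (d := fun t => (W (M.stepN π₁ M.μ t) (M.stepN π₂ M.μ t)).toReal) (b := Lπ * w) (L := Lμ)
      h0 (fun t => ?_) (by positivity) Lμ.2 M.γ_nonneg M.γ_lt_one hγL N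
    · refine this.trans (le_of_eq ?_)
      ring
    · have h1 : (Lπ : ℝ≥0∞) * ENNReal.ofReal w ≠ ⊤ :=
        ENNReal.mul_ne_top ENNReal.coe_ne_top ENNReal.ofReal_ne_top
      have h2 : (Lμ : ℝ≥0∞) * W (M.stepN π₁ M.μ t) (M.stepN π₂ M.μ t) ≠ ⊤ :=
        ENNReal.mul_ne_top ENNReal.coe_ne_top (hfin t)
      have := ENNReal.toReal_mono (ENNReal.add_ne_top.2 ⟨h1, h2⟩) (hrec t)
      rwa [ENNReal.toReal_add h1 h2, ENNReal.toReal_mul, ENNReal.toReal_mul,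
        ENNReal.toReal_ofReal hw0, ENNReal.coe_toReal, ENNReal.coe_toReal] at this
  · have hpos : 0 < 1 - M.γ * L := by have := (abs_lt.1 hγL).2; linarith
    -- The distances are bounded uniformly by `L_π w / (1 - γ L)`; discounting from `t = 1` on adds
    -- the factor `γ / (1 - γ)`, so the constant agrees with that of the Lipschitz case.
    rw [tsum_geometric_of_abs_lt_one hγL] at hstab
    have hC : M.stabilityConst π₁ π₂ ≠ ⊤ := ne_top_of_le_ne_top ENNReal.ofReal_ne_top hstab
    have hle : ∀ t, W (M.stepN π₁ M.μ t) (M.stepN π₂ M.μ t) ≤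
        ENNReal.ofReal (Lπ * (1 - M.γ * L)⁻¹ * w) := by
      intro t
      rw [ENNReal.ofReal_mul (by positivity)]
      exact (M.W_stepN_le_stabilityConst π₁ π₂ hLπ hwne hC t).trans (mul_le_mul' hstab hw)
    refine ⟨fun t => ne_top_of_le_ne_top ENNReal.ofReal_ne_top (hle t), fun N => ?_⟩
    have h1 : 0 < 1 - M.γ := sub_pos.2 M.γ_lt_one
    have := sum_pow_mul_le_of_le
      (d := fun t => (W (M.stepN π₁ M.μ t) (M.stepN π₂ M.μ t)).toReal) h0
      (fun t => ENNReal.toReal_le_of_le_ofReal (by positivity) (hle t)) (by positivity)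
      M.γ_nonneg M.γ_lt_one N
    refine this.trans (le_of_eq ?_)
    field_simp

end MDP

/-! ### The surrogate -/

lemma EReal.sub_coe_ennreal_le (x : EReal) (a : ℝ≥0∞) : x - a ≤ x :=
  (EReal.sub_le_sub le_rfl (EReal.coe_ennreal_nonneg a)).trans (by simp)

section Surrogate

variable {n m : ℕ} {S : Set (EuclideanSpace ℝ (Fin n))} {A : Set (EuclideanSpace ℝ (Fin m))}
  (M : MDP S A) (π₁ π₂ : Kernel S A) (Lπ : ℝ≥0) (L α : ℝ)

lemma C₁'_eq : C₁' M π₁ Lπ L = 2 * (⨆ s, Lip A (M.Q π₁ s)) *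
    ENNReal.ofReal (M.γ * Lπ / ((1 - M.γ) * (1 - M.γ * L))) := by
  rw [C₁', ENNReal.mul_iSup, ENNReal.iSup_mul]

lemma C₂'_eq : C₂' M π₁ Lπ L = (⨆ s, lipGrad (M.Q π₁) s) *
    ENNReal.ofReal (M.γ * Lπ / ((1 - M.γ) * (1 - M.γ * L))) := by
  rw [C₂', ENNReal.iSup_mul]

lemma surrogate_le : surrogate M π₁ π₂ Lπ L α ≤
    ((M.payoff π₁ + 1 / (1 - M.γ) * ∫ s, M.adv π₁ s π₂ ∂(M.visitation π₁ M.μ) : ℝ) : EReal) :=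
  (EReal.sub_coe_ennreal_le _ _).trans (EReal.sub_coe_ennreal_le _ _)

lemma surrogate_eq_bot (h : C₁ M π₁ Lπ L α * (⨆ s, LG2 π₁ π₂ s) = ⊤ ∨
    C₂ M π₁ Lπ L α * (⨆ s, W (π₂ s) (π₁ s) ^ 2) = ⊤) : surrogate M π₁ π₂ Lπ L α = ⊥ := by
  unfold surrogate
  rcases h with h | h <;> rw [h] <;> simp

variable [IsMarkovKernel π₁] [IsMarkovKernel π₂]

/-- `Q` is then constant in the action, so both policies give it the same mean. This covers `C₁ = 0`
together with an infinite supremum of `LG2`. -/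
lemma adv_eq_zero_of_Lip_eq_zero (hA : Convex ℝ A) (hQa : ∀ s, DiffOn A (M.Q π₁ s))
    (h : ⨆ s, Lip A (M.Q π₁ s) = 0) (s : S) : M.adv π₁ s π₂ = 0 := by
  have hL : Lip A (M.Q π₁ s) = 0 := le_antisymm
    ((le_iSup (fun s => Lip A (M.Q π₁ s)) s).trans h.le) bot_le
  obtain ⟨a₀⟩ : Nonempty A := nonempty_of_isProbabilityMeasure (π₁ s)
  have hconst : ∀ a, M.Q π₁ s a = M.Q π₁ s a₀ := by
    intro a
    have := (hQa s).abs_sub_le hA (by simp [hL]) a a₀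
    rw [hL, ENNReal.toReal_zero, zero_mul] at this
    exact sub_eq_zero.1 (abs_nonpos_iff.1 this)
  rw [M.adv_eq]
  simp [hconst]

end Surrogate

end TDPO

end

/-! ### The payoff improvement guarantee -/

open MeasureTheory ProbabilityTheory TDPO in
theorem mainTheorem1 {n m : ℕ}
    (S : Set (EuclideanSpace ℝ (Fin n))) (hSopen : IsOpen S) (hSconv : Convex ℝ S)
    (A : Set (EuclideanSpace ℝ (Fin m))) (hAconv : Convex ℝ A)
    (M : MDP S A) (π₁ π₂ : Kernel S A) [IsMarkovKernel π₁] [IsMarkovKernel π₂]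
    -- existence of the gradients and Lipschitz constants of `Q^{π₁}`
    (hQa : ∀ s, DiffOn A (M.Q π₁ s))
    (hQs : ∀ a, DiffOn S (fun s => M.Q π₁ s a))
    (hQsa : ∀ s j, DiffOn A (fun a => pderiv S (fun s' => M.Q π₁ s' a) s j))
    (hLip : (⨆ s, Lip A (M.Q π₁ s)) ≠ ⊤)
    (hLipGrad : (⨆ s, lipGrad (M.Q π₁) s) ≠ ⊤)
    -- the dynamics is Lipschitz in the policy
    (Lπ : NNReal) (hLπ : M.PolicyLipschitz π₁ π₂ Lπ)
    -- either it is `L`-Lipschitz in the state distribution with `γ L < 1`,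
    -- or it is stable, `L` being the effective constant with `C_L ≤ L_π ∑ₜ (γ L)ᵗ`
    (L : ℝ)
    (hL : (∃ Lμ : NNReal, L = Lμ ∧ M.γ * Lμ < 1 ∧
            M.StateLipschitz π₁ Lμ ∧ M.StateLipschitz π₂ Lμ) ∨
          (|M.γ * L| < 1 ∧
            M.stabilityConst π₁ π₂ ≤ ENNReal.ofReal (Lπ * ∑' t : ℕ, (M.γ * L) ^ t)))
    (α : ℝ) (hα : α ≠ 0) :
    surrogate M π₁ π₂ Lπ L α ≤ (M.payoff π₂ : EReal) := by
  have : StandardBorelSpace S := hSopen.measurableSet.standardBorel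
  have hγ1 : 0 < 1 - M.γ := sub_pos.2 M.γ_lt_one
  have hγL : 0 < 1 - M.γ * L := by
    rcases hL with ⟨Lμ, rfl, h, -⟩ | ⟨h, -⟩
    · linarith
    · have := (abs_lt.1 h).2; linarith
  set κ := M.γ * Lπ / ((1 - M.γ) * (1 - M.γ * L)) with hκ
  have hκ0 : 0 ≤ κ := by have := M.γ_nonneg; positivity
  -- Both coefficients vanish here, so infinite suprema no longer make the surrogate `-∞`; exactness
  -- of the first-order approximation is needed instead.
  by_cases hκz : κ = 0
  · have h0 : M.γ * Lπ = 0 := (div_eq_zero_iff.1 hκz).resolve_right (by positivity)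
    rw [M.payoff_eq_of_mul_eq_zero π₁ π₂ hLπ h0]
    exact surrogate_le M π₁ π₂ Lπ L α
  have hκpos : 0 < κ := lt_of_le_of_ne hκ0 (Ne.symm hκz)
  by_cases hlz : ⨆ s, Lip A (M.Q π₁ s) = 0
  · have hadv := adv_eq_zero_of_Lip_eq_zero M π₁ π₂ hAconv hQa hlz
    have hpay : M.payoff π₁ + 1 / (1 - M.γ) *
        ∫ s, M.adv π₁ s π₂ ∂(M.visitation π₁ M.μ) = M.payoff π₂ := by
      refine (sub_eq_zero.1 ((M.hasSum_payoff_sub_approx π₁ π₂).unique ?_)).symm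
      exact hasSum_of_forall_eq hasSum_zero fun t => by simp [hadv]
    rw [← hpay]
    exact surrogate_le M π₁ π₂ Lπ L α
  have hC₁' : C₁' M π₁ Lπ L ≠ 0 := by
    rw [C₁'_eq]
    exact mul_ne_zero (mul_ne_zero two_ne_zero hlz) (ENNReal.ofReal_pos.2 hκpos).ne'
  have hα2 : 0 < α ^ 2 := by positivity
  by_cases hG : ⨆ s, LG2 π₁ π₂ s = ⊤
  · rw [surrogate_eq_bot M π₁ π₂ Lπ L α (Or.inl ?_)]
    · exact bot_le
    rw [hG, ENNReal.mul_top]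
    exact mul_ne_zero hC₁' (ENNReal.ofReal_pos.2 (by positivity)).ne'
  by_cases hV : ⨆ s, W (π₂ s) (π₁ s) ^ 2 = ⊤
  · rw [surrogate_eq_bot M π₁ π₂ Lπ L α (Or.inr ?_)]
    · exact bot_le
    rw [hV, ENNReal.mul_top]
    -- `C₂` is nonzero through its summand `C₁' / (2 α²)`, whatever `C₂'` is.
    exact fun h => mul_ne_zero hC₁' (ENNReal.ofReal_pos.2 (by positivity)).ne'
      (add_eq_zero.1 h).2
  set l := (⨆ s, Lip A (M.Q π₁ s)).toReal with hl
  set k := (⨆ s, lipGrad (M.Q π₁) s).toReal with hk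
  set g := √(⨆ s, LG2 π₁ π₂ s).toReal with hg
  set w := √(⨆ s, W (π₂ s) (π₁ s) ^ 2).toReal with hw
  have hl0 : 0 ≤ l := ENNReal.toReal_nonneg
  have hk0 : 0 ≤ k := ENNReal.toReal_nonneg
  have hg0 : 0 ≤ g := Real.sqrt_nonneg _
  have hw0 : 0 ≤ w := Real.sqrt_nonneg _
  have el : ⨆ s, Lip A (M.Q π₁ s) = ENNReal.ofReal l := (ENNReal.ofReal_toReal hLip).symm
  have ek : ⨆ s, lipGrad (M.Q π₁) s = ENNReal.ofReal k := (ENNReal.ofReal_toReal hLipGrad).symm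
  have eg : ⨆ s, LG2 π₁ π₂ s = ENNReal.ofReal (g ^ 2) := by
    rw [hg, Real.sq_sqrt ENNReal.toReal_nonneg, ENNReal.ofReal_toReal hG]
  have ew : ⨆ s, W (π₂ s) (π₁ s) ^ 2 = ENNReal.ofReal (w ^ 2) := by
    rw [hw, Real.sq_sqrt ENNReal.toReal_nonneg, ENNReal.ofReal_toReal hV]
  have hWw : ∀ s, W (π₂ s) (π₁ s) ≤ ENNReal.ofReal w := by
    intro s
    have := (le_iSup (fun s => W (π₂ s) (π₁ s) ^ 2) s).trans ew.le
    rw [ENNReal.ofReal_pow hw0] at this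
    exact (ENNReal.pow_le_pow_left_iff two_ne_zero).1 this
  have hpol : policyW π₁ π₂ ≤ ENNReal.ofReal w :=
    iSup_le fun s => (W_comm _ _).le.trans (hWw s)
  obtain ⟨hfin, hsum⟩ := M.sum_pow_mul_W_le π₁ π₂ hLπ hL hw0 hpol
  have hadv := abs_adv_sub_le M π₁ π₂ hSopen hSconv hAconv hQa hQs hQsa hl0
    (fun s => (le_iSup (fun s => Lip A (M.Q π₁ s)) s).trans el.le) hk0
    (fun s => (le_iSup (fun s => lipGrad (M.Q π₁) s) s).trans ek.le) hg0
    (fun s => (le_iSup (fun s => LG2 π₁ π₂ s) s).trans eg.le) hw0 hWw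
  have hlow := M.le_payoff_of_abs_adv_sub_le π₁ π₂ (by positivity) hadv hfin hsum
  have hfirst : C₁ M π₁ Lπ L α * (⨆ s, LG2 π₁ π₂ s) =
      ENNReal.ofReal (2 * l * κ * (α ^ 2 / 2) * g ^ 2) := by
    rw [C₁, C₁'_eq, el, eg, ENNReal.ofReal_mul (by positivity), ENNReal.ofReal_mul (by positivity),
      ENNReal.ofReal_mul (by positivity), ENNReal.ofReal_mul (by positivity), ENNReal.ofReal_ofNat]
  have hsecond : C₂ M π₁ Lπ L α * (⨆ s, W (π₂ s) (π₁ s) ^ 2) =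
      ENNReal.ofReal ((k * κ + 2 * l * κ * (1 / (2 * α ^ 2))) * w ^ 2) := by
    rw [C₂, C₂'_eq, C₁'_eq, el, ek, ew, ENNReal.ofReal_mul (by positivity),
      ENNReal.ofReal_add (by positivity) (by positivity), ENNReal.ofReal_mul hk0,
      ENNReal.ofReal_mul (by positivity : 0 ≤ 2 * l * κ),
      ENNReal.ofReal_mul (by positivity : 0 ≤ 2 * l), ENNReal.ofReal_mul zero_le_two,
      ENNReal.ofReal_ofNat]
  -- The cross term `2 l κ g w` of the error is split between the two penalties, with `α²` fixing
  -- the exchange rate.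
  have hamgm : 2 * (g * w) ≤ α ^ 2 * g ^ 2 + w ^ 2 / α ^ 2 := by
    have h := sq_nonneg (α * g - w / α)
    have e : (α * g - w / α) ^ 2 = α ^ 2 * g ^ 2 + w ^ 2 / α ^ 2 - 2 * (g * w) := by
      field_simp
      ring
    linarith
  unfold surrogate
  rw [hfirst, hsecond, EReal.coe_ennreal_ofReal, EReal.coe_ennreal_ofReal,
    max_eq_left (by positivity), max_eq_left (by positivity), ← EReal.coe_sub, ← EReal.coe_sub,
    EReal.coe_le_coe_iff]
  refine le_trans ?_ hlow
  have h1 := mul_le_mul_of_nonneg_left hamgm (by positivity : 0 ≤ l * κ)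
  have e1 : (2 * l * g + k * w) * (κ * w) = l * κ * (2 * (g * w)) + k * κ * w ^ 2 := by ring
  have e2 : (k * κ + 2 * l * κ * (1 / (2 * α ^ 2))) * w ^ 2 =
      k * κ * w ^ 2 + l * κ * (w ^ 2 / α ^ 2) := by
    field_simp
  have e3 : 2 * l * κ * (α ^ 2 / 2) * g ^ 2 = l * κ * (α ^ 2 * g ^ 2) := by ring
  rw [e1, e2, e3]
  linarith
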